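/- **Theorem 2 (Regret bound of Delayed Lipschitz Phased Pruning).** *Setting.* Let $(\mathcal A,\mathcal D)$ be a nonempty compact metric space of diameter at most $1$ that is doubling with constant $N$ (every closed ball is covered by at most $N$ closed balls of half its radius), and let $\mu:\mathcal A\to[0,1]$ be $1$-Lipschitz, $\mu^*=\max_{\mathcal A}\mu$, $\Delta(x)=\mu^*-\mu(x)$. In round $t=1,\dots,T$ an arm $x_t$ is pulled and the reward $y_t=\mu(x_t)+\epsilon_t$ is generated; it is observed in round $t+\tau_t$. The delays $\tau_t\in\mathbb N\cup\{\infty\}$ are i.i.d. ($\tau_t=\infty$ means that the reward is never observed); each $\tau_t$ is independent of the earlier delays and of the arms and rewards up to and including round $t$. The noise $\epsilon_t$ is sub-Gaussian with parameter $1$ conditionally on $x_1,\dots,x_t$, $\epsilon_1,\dots,\epsilon_{t-1}$ and the delays. Let $Q(p)=\min\{n\in\mathbb N: \Pr(\tau\le n)\ge p\}$ ($=\infty$ if there is no such $n$), and $R(T)=\sum_{t=1}^T\Delta(x_t)$. For $r\in(0,1]$ let $N_z(r)$ be the least number of balls of radius at most $r/16$ that cover $\{x:\Delta(x)\le r\}$.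 Let $d_z\ge 0$ and $c>0$ be such that $N_z(r)\le c\,r^{-d_z}$ for all $r\in(0,1]$ (the zooming dimension is the smallest such exponent, $c$ the corresponding constant). *Algorithm (DLPP), with input $T$ and $\delta$.* Put $r_m=2^{-m}$ and $v_m=(4\log T+2\log(2/\delta))/r_m^2$. Phase $1$ starts with the balls of radius $r_1$ around the points of a minimum-cardinality $r_1$-covering of $\mathcal A$. In phase $m$, with the finite family $\mathcal B_m$ of balls of radius $r_m$, the active balls (at first all of $\mathcal B_m$) are played in round-robin fashion, one per round, where playing a ball $B$ means pulling some arm of $B$ (for example a uniformly random one). After each round the rewards arriving in that round are added to the empirical means $\hat\mu_m(B)$ and the numbers of observations $v(B)$ of the balls of the current phase from which they stem, and every ball with $v(B)\ge v_m$ ceases to be active in this phase. When no ball is active, every $B\in\mathcal B_m$ with $\max_{B'\in\mathcal B_m}\hat\mu_m(B')-\hat\mu_m(B)\ge 4r_m$ is eliminated, $\mathcal B_{m+1}$ consists of the balls of radius $r_{m+1}=r_m/2$ around the points of a minimum-cardinality $r_{m+1}$-covering of the union of the surviving balls, and phase $m+1$ begins. The algorithm stops after round $T$. *Claim.* For every $N$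 there is a constant $C>0$, depending on $N$ only, such that in every such setting, for all $T\ge 2$ and $\delta\in(0,1)$, with probability at least $1-\delta$ DLPP attains $$R(T)\;\le\; C\,\min_{p\in(0,1]}\left\{\frac1p\,T^{\frac{d_z+1}{d_z+2}}\left(c\log\frac T\delta\right)^{\frac1{d_z+2}}+Q(p)\right\}.$$ -/

import Mathlib

open MeasureTheory ProbabilityTheory
open scoped ENNReal

namespace DelayedLipschitz

noncomputable section

universe u v

/-! ### Metric notions -/

/-- `A` is a doubling metric space with doubling constant `N`: every closed ball is covered by at
most `N` closed balls of half the radius. -/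
def IsDoubling (A : Type u) [MetricSpace A] (N : ℕ) : Prop :=
  ∀ (x : A) (r : ℝ), 0 < r → ∃ F : Finset A, F.card ≤ N ∧
    Metric.closedBall x r ⊆ ⋃ y ∈ F, Metric.closedBall y (r / 2)

/-- The optimality gap `Δ(x) = μ* - μ(x)`, where `μ*` is the supremum of `μ`
(a maximum when `μ` is continuous on a nonempty compact space). -/
def gap {A : Type u} (μ : A → ℝ) (x : A) : ℝ := (⨆ y, μ y) - μ x

/-- The `r`-zooming number: the least number of balls of radius at most `r / 16` (equivalently, of
closed balls of radius exactly `r / 16`) that cover the `r`-optimal region `{x | Δ(x) ≤ r}`. -/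
def zoomingNumber {A : Type u} [MetricSpace A] (μ : A → ℝ) (r : ℝ) : ℕ∞ :=
  Metric.externalCoveringNumber (r / 16).toNNReal {x | gap μ x ≤ r}

/-- `N_z(r) ≤ c r ^ (-d)` for all `r ∈ (0, 1]`. The zooming dimension is the smallest exponent
`d ≥ 0` for which this holds, with its constant `c > 0`. -/
def HasZoomingBound {A : Type u} [MetricSpace A] (μ : A → ℝ) (c d : ℝ) : Prop :=
  0 < c ∧ 0 ≤ d ∧ ∀ r : ℝ, 0 < r → r ≤ 1 →
    ((zoomingNumber μ r : ℕ∞) : ℝ≥0∞) ≤ ENNReal.ofReal (c * r ^ (-d))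

/-! ### Delays -/

/-- The quantile function of a delay distribution `ν` on `ℕ ∪ {∞}`:
the least `n : ℕ` with `ν [0, n] ≥ p`, and `∞` if there is no such `n`. -/
def quantile (ν : Measure ℕ∞) (p : ℝ) : ℕ∞ :=
  ⨅ (n : ℕ) (_ : ENNReal.ofReal p ≤ ν (Set.Iic (n : ℕ∞))), (n : ℕ∞)

/-! ### The algorithm

Rounds are numbered `0, …, T - 1`. A ball of phase `m` is recorded by `m` and its centre; its
radius is `2 ^ (-m)`. -/

/-- The choices which the algorithm leaves open: a covering oracle, which returns for a set `S` and
a radius `r` the centres of a smallest family of closed balls of radius `r` covering `S`, and the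
order in which a finite family of balls is run through. -/
structure Choices (A : Type u) [MetricSpace A] where
  cover : Set A → ℝ → Finset A
  enum : Finset A → List A
  isCover_cover : ∀ (S : Set A) (r : ℝ), 0 < r → Metric.IsCover r.toNNReal S (cover S r : Set A)
  card_cover : ∀ (S : Set A) (r : ℝ), 0 < r →
    ((cover S r).card : ℕ∞) = Metric.externalCoveringNumber r.toNNReal S
  nodup_enum : ∀ F : Finset A, (enum F).Nodup
  mem_enum : ∀ (F : Finset A) (x : A), x ∈ enum F ↔ x ∈ F

/-- A scheduled reward: the ball that was played (phase and centre), the round in which the reward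
is observed (`∞` if never), and the reward. -/
structure Feedback (A : Type u) where
  phase : ℕ
  center : A
  arrival : ℕ∞
  reward : ℝ

/-- The state of the algorithm at the beginning of a round: the current phase `m`, the centres of
the balls in `𝓑_m`, the balls still to be played in the current round-robin pass (in that order),
and the rewards scheduled so far. -/
structure State (A : Type u) where
  phase : ℕ
  centers : Finset A
  queue : List A
  scheduled : List (Feedback A)

/-- The radius `r_m = 2 ^ (-m)`. -/
def radius (m : ℕ) : ℝ := (1 / 2 : ℝ) ^ m

/-- The required number of observations `v_m = (4 log T + 2 log (2 / δ)) / r_m ^ 2`. -/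
def threshold (T : ℕ) (δ : ℝ) (m : ℕ) : ℝ :=
  (4 * Real.log T + 2 * Real.log (2 / δ)) / radius m ^ 2

open scoped Classical in
/-- The rewards of the ball of phase `m` with centre `x` that are observed up to the end of
round `t`. -/
def observed {A : Type u} (L : List (Feedback A)) (t m : ℕ) (x : A) : List ℝ :=
  (L.filter (fun f => f.phase = m ∧ f.center = x ∧ f.arrival ≤ (t : ℕ∞))).map Feedback.reward

/-- The number `v(B)` of observed rewards of a ball. -/
def obsCount {A : Type u} (L : List (Feedback A)) (t m : ℕ) (x : A) : ℕ :=
  (observed L t m x).length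

/-- The empirical mean `μ̂_m(B)` of the observed rewards of a ball (`0` if there are none). -/
def empMean {A : Type u} (L : List (Feedback A)) (t m : ℕ) (x : A) : ℝ :=
  (observed L t m x).sum / obsCount L t m x

/-- The initial state: phase `1`, balls of radius `1 / 2` covering the whole space. -/
def init {A : Type u} [MetricSpace A] (ch : Choices A) : State A where
  phase := 1
  centers := ch.cover Set.univ (radius 1)
  queue := ch.enum (ch.cover Set.univ (radius 1))
  scheduled := []

open scoped Classical in
/-- The centres of the balls that survive the elimination at the end of round `t`: the ball at `x`
is eliminated iff `max_B μ̂_m(B) - μ̂_m(x) ≥ 4 r_m`. -/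
def survivors {A : Type u} (F : Finset A) (L : List (Feedback A)) (t m : ℕ) : Finset A :=
  F.filter (fun x => ∀ y ∈ F, empMean L t m y - empMean L t m x < 4 * radius m)

/-- The state at the beginning of the next phase: the region covered by the surviving balls is
covered by balls of half the radius. -/
def nextPhase {A : Type u} [MetricSpace A] (ch : Choices A) (t : ℕ) (s : State A)
    (L : List (Feedback A)) : State A :=
  let S : Set A := ⋃ x ∈ survivors s.centers L t s.phase, Metric.closedBall x (radius s.phase)
  let F : Finset A := ch.cover S (radius s.phase / 2)
  { phase := s.phase + 1, centers := F, queue := ch.enum F, scheduled := L }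

open scoped Classical in
/-- Round `t`, in which the first ball of the queue is played and yields reward `y` with delay
`τ`. The reward is scheduled for round `t + τ`, the rewards arriving in round `t` are taken into
account, and the balls of the current phase with at least `v_m` observations are no longer active.
Then the pass continues with the balls of the queue that are still active; if there are none, a
new pass over the active balls begins; if no ball is active, the next phase begins. -/
def step {A : Type u} [MetricSpace A] (ch : Choices A) (T : ℕ) (δ : ℝ) (t : ℕ) (y : ℝ) (τ : ℕ∞)
    (s : State A) : State A :=
  match s.queue with
  | [] => s
  | z :: rest =>
    let L : List (Feedback A) := ⟨s.phase, z, (t : ℕ∞) + τ, y⟩ :: s.scheduled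
    let active : Finset A :=
      s.centers.filter (fun x => (obsCount L t s.phase x : ℝ) < threshold T δ s.phase)
    let rest' : List A := rest.filter (fun x => x ∈ active)
    if rest' ≠ [] then { s with queue := rest', scheduled := L }
    else if active.Nonempty then { s with queue := ch.enum active, scheduled := L }
    else nextPhase ch t s L

/-- The state at the beginning of round `t`, when the plays yield the rewards `y 0, y 1, …` with
delays `τ 0, τ 1, …`. It depends on `y s` and `τ s` for `s < t` only, and on `y s` only from
round `s + τ s` on. -/
def state {A : Type u} [MetricSpace A] (ch : Choices A) (T : ℕ) (δ : ℝ) (y : ℕ → ℝ) (τ : ℕ → ℕ∞) :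
    ℕ → State A
  | 0 => init ch
  | t + 1 => step ch T δ t (y t) (τ t) (state ch T δ y τ t)

/-! ### The stochastic model -/

/-- `Z` is conditionally sub-Gaussian with parameter `1` (and hence centred) given `m`. -/
def CondSubGaussian {Ω : Type v} {mΩ : MeasurableSpace Ω} (P : Measure Ω) (m : MeasurableSpace Ω)
    (Z : Ω → ℝ) : Prop :=
  ∀ l : ℝ, Integrable (fun ω => Real.exp (l * Z ω)) P ∧
    P[fun ω => Real.exp (l * Z ω) | m] ≤ᵐ[P] fun _ => Real.exp (l ^ 2 / 2)

/-- The information generated by `Z s`, `s ∈ I`. -/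
abbrev info {Ω : Type v} {E : Type*} [mE : MeasurableSpace E] (Z : ℕ → Ω → E) (I : Set ℕ) :
    MeasurableSpace Ω :=
  ⨆ s ∈ I, MeasurableSpace.comap (Z s) mE

/-- The algorithm with horizon `T` and parameter `δ` interacts with the delayed Lipschitz bandit
with mean reward `μ` and delay distribution `ν`: in round `t < T` the arm `X t` is pulled, the
reward `μ (X t) + ε t` is generated, and it is observed in round `t + τ t`. -/
structure IsRun {A : Type u} [MetricSpace A] [MeasurableSpace A] (ch : Choices A) (T : ℕ) (δ : ℝ)
    (μ : A → ℝ) (ν : Measure ℕ∞) {Ω : Type v} {mΩ : MeasurableSpace Ω} (P : Measure Ω)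
    (X : ℕ → Ω → A) (ε : ℕ → Ω → ℝ) (τ : ℕ → Ω → ℕ∞) : Prop where
  measurable_arm : ∀ t, Measurable (X t)
  measurable_noise : ∀ t, Measurable (ε t)
  measurable_delay : ∀ t, Measurable (τ t)
  /-- The arm pulled in round `t` lies in the ball which the algorithm plays in that round. -/
  arm_mem : ∀ t < T, ∀ ω, ∃ z,
    (state ch T δ (fun s => μ (X s ω) + ε s ω) (fun s => τ s ω) t).queue.head? = some z ∧
    X t ω ∈ Metric.closedBall z
      (radius (state ch T δ (fun s => μ (X s ω) + ε s ω) (fun s => τ s ω) t).phase)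
  /-- The noise is sub-Gaussian given the arms pulled so far (the current one included), the past
  noise, and the delays. -/
  noise : ∀ t < T, CondSubGaussian P
    (info X (Set.Iic t) ⊔ info ε (Set.Iio t) ⊔ info τ (Set.Iio T)) (ε t)
  /-- The delays have distribution `ν`. -/
  delay_law : ∀ t < T, P.map (τ t) = ν
  /-- Each delay is independent of the earlier delays and of the arms and the noise (hence the
  rewards) up to and including its round. In particular the delays are i.i.d. -/
  delay_indep : ∀ t < T, Indep (info τ {t})
    (info X (Set.Iic t) ⊔ info ε (Set.Iic t) ⊔ info τ (Set.Iio t)) P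

/-- The regret `R(T) = ∑_t (μ* - μ(x_t))`. -/
def regret {A : Type u} {Ω : Type v} (μ : A → ℝ) (T : ℕ) (X : ℕ → Ω → A) (ω : Ω) : ℝ :=
  ∑ t ∈ Finset.range T, gap μ (X t ω)

end

end DelayedLipschitz

open DelayedLipschitz

/-!
The regret is bounded on an event of probability at least `1 - δ` on which the noise and the delays
behave as expected; there the argument is deterministic.

*The noise* (`NoiseGood`). In a phase of radius `r` a ball collects `n ≥ v = 2 ℓ / r ^ 2`
observations, where `2 exp (-ℓ) = δ / T ^ 2`. Whether the reward of a round counts for the ball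
first played in round `s₀` and is observed by the end of round `u` is determined by the arms, the
past noise and the delays, given which the current noise is sub-Gaussian. Hence
`exp (± r ∑ ε - n r ^ 2 / 2)` is a supermartingale, and `|∑ ε| ≥ n r` has probability at most
`2 exp (-ℓ)`. No bound on the number of balls is needed, only one on the number of pairs `s₀ < u`.

*The delays* (`DelayGood`). For the quantile `q` of level `p`, the plays of a ball with delay at
most `q` number at least `p n / 2 - ℓ` out of `n`, by the supermartingale
`exp (p n / 2 - #{τ ≤ q})`; here the ball played in a round is determined by the past, and the delay
of the round is independent of it.

*Elimination* (`exists_centers_eq_cover`, `gap_le_of_noiseGood`). Empirical means are then within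
`r_k` of the average mean reward of the pulled arms, so the ball of an optimal arm always survives,
and every arm of phase `k` has gap at most `22 r_k`. By the zooming and doubling assumptions the
number of balls of phase `k` is at most `N ^ 5 c r_k ^ (-d)` (`Choices.card_cover_le`).

*Length of a phase* (`card_phase_le_of_delayGood`). In the last round `t` of a phase some ball is
played, which has fewer than `v` observations. All its plays before round `t - q` with delay at most
`q` have been observed, so there are only `O (v / p)` plays of it before round `t - q`. In
round-robin play no other ball has been played more than once more by then. Hence the phase has at
most `O (v / p)` rounds per ball and `q + 1` further rounds. Counting the last rounds once for the
whole phase, and not once for every ball, avoids a logarithm of the number of balls.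

Summing up, `R(T) ≲ c ℓ / p * r_M ^ (-(d + 1)) + q + r_M T` for every `M`, and
`r_M ≈ (c log (T / δ) / T) ^ (1 / (d + 2))` gives the claim for one level `p`. As the right-hand
side of the theorem is deterministic, it suffices to apply this to one `p` which comes within a
factor two of the infimum.

That the state of the algorithm is measurable in the past needs an argument, since the covers are
chosen arbitrarily: apart from the scheduled rewards, the state takes countably many values
(`StateMeasurableOn`).
-/

namespace DelayedLipschitz

/-! ### Exponential supermartingales -/

section Supermartingale

variable {Ω : Type*}

/-- The conditional expectation of the nonnegative function `G` given `m` is at most `1`. It is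
expressed by the integrals over the events of `m`, so that no integrability has to be checked. -/
def CondExpLeOne {mΩ : MeasurableSpace Ω} (P : Measure Ω) (m : MeasurableSpace Ω)
    (G : Ω → ℝ≥0∞) : Prop :=
  Measurable[mΩ] G ∧ ∀ S, MeasurableSet[m] S → ∫⁻ ω in S, G ω ∂P ≤ P S

variable {m mΩ : MeasurableSpace Ω} {P : Measure Ω}

theorem condExpLeOne_one : CondExpLeOne P m (fun _ => 1) :=
  ⟨measurable_const, fun S _ => by simp⟩

theorem CondExpLeOne.lintegral_mul_le {G Y : Ω → ℝ≥0∞} (hG : CondExpLeOne P m G) (hm : m ≤ mΩ)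
    (hY : Measurable[m] Y) : ∫⁻ ω, Y ω * G ω ∂P ≤ ∫⁻ ω, Y ω ∂P := by
  calc ∫⁻ ω, Y ω * G ω ∂P = ∫⁻ ω, Y ω ∂(P.withDensity G) := by
        rw [lintegral_withDensity_eq_lintegral_mul _ hG.1 (hY.mono hm le_rfl)]
        simp [mul_comm]
    _ = ∫⁻ ω, Y ω ∂((P.withDensity G).trim hm) := (lintegral_trim hm hY).symm
    _ ≤ ∫⁻ ω, Y ω ∂(P.trim hm) := by
        refine lintegral_mono' (Measure.le_iff.2 fun S hS => ?_) le_rfl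
        rw [trim_measurableSet_eq hm hS, trim_measurableSet_eq hm hS, withDensity_apply _ (hm _ hS)]
        exact hG.2 S hS
    _ = ∫⁻ ω, Y ω ∂P := lintegral_trim hm hY

/-- Choosing one of countably many functions by an `m`-measurable rule preserves the bound. -/
theorem CondExpLeOne.select {ι : Type*} [Countable ι] {G : ι → Ω → ℝ≥0∞}
    (hG : ∀ i, CondExpLeOne P m (G i)) (hm : m ≤ mΩ) {κ : Ω → ι}
    (hκ : ∀ i, MeasurableSet[m] (κ ⁻¹' {i})) : CondExpLeOne P m (fun ω => G (κ ω) ω) := by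
  refine ⟨fun B hB => ?_, fun S hS => ?_⟩
  · have : (fun ω => G (κ ω) ω) ⁻¹' B = ⋃ i, κ ⁻¹' {i} ∩ G i ⁻¹' B := by
      ext ω; simp
    rw [this]
    exact MeasurableSet.iUnion fun i => (hm _ (hκ i)).inter ((hG i).1 hB)
  · have hS' : S = ⋃ i, S ∩ κ ⁻¹' {i} := by ext ω; simp
    have hdisj : Pairwise (Function.onFun Disjoint fun i => S ∩ κ ⁻¹' {i}) := by
      intro i j hij
      refine Set.disjoint_left.2 fun ω hi hj => hij ?_
      rw [← hi.2, ← hj.2]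
    have hmeas : ∀ i, MeasurableSet (S ∩ κ ⁻¹' {i}) := fun i => hm _ (hS.inter (hκ i))
    calc ∫⁻ ω in S, G (κ ω) ω ∂P = ∑' i, ∫⁻ ω in S ∩ κ ⁻¹' {i}, G (κ ω) ω ∂P := by
          conv_lhs => rw [hS']
          exact lintegral_iUnion hmeas hdisj _
      _ = ∑' i, ∫⁻ ω in S ∩ κ ⁻¹' {i}, G i ω ∂P := by
          refine tsum_congr fun i => setLIntegral_congr_fun (hmeas i) fun ω hω => ?_
          have : κ ω = i := hω.2
          simp [this]
      _ ≤ ∑' i, P (S ∩ κ ⁻¹' {i}) := ENNReal.tsum_le_tsum fun i => (hG i).2 _ (hS.inter (hκ i))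
      _ = P S := by
          conv_rhs => rw [hS']
          exact (measure_iUnion hdisj hmeas).symm

/-- The exponential supermartingale bound: if every `exp (D s)` has conditional expectation at most
`1` given a past `F s` which determines the earlier terms, then `∑ D s` has an exponential tail. -/
theorem measure_le_sum_le_exp_neg [IsProbabilityMeasure P] (F : ℕ → MeasurableSpace Ω)
    (D : ℕ → Ω → ℝ) (n : ℕ) (hF : ∀ s < n, F s ≤ mΩ)
    (hD : ∀ s < n, CondExpLeOne P (F s) fun ω => ENNReal.ofReal (Real.exp (D s ω)))
    (hadapt : ∀ s < n, ∀ j < s, Measurable[F s] (D j)) (a : ℝ) :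
    P {ω | a ≤ ∑ s ∈ Finset.range n, D s ω} ≤ ENNReal.ofReal (Real.exp (-a)) := by
  have key : ∀ k ≤ n, ∫⁻ ω, ENNReal.ofReal (Real.exp (∑ s ∈ Finset.range k, D s ω)) ∂P ≤ 1 := by
    intro k
    induction k with
    | zero => intro _; simp
    | succ k ih =>
      intro hk
      have hY : Measurable[F k]
          fun ω => ENNReal.ofReal (Real.exp (∑ s ∈ Finset.range k, D s ω)) := by
        refine ENNReal.measurable_ofReal.comp (Real.measurable_exp.comp ?_)
        exact Finset.measurable_sum _ fun j hj => hadapt k hk j (Finset.mem_range.1 hj)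
      refine le_trans (le_of_eq ?_)
        (((hD k hk).lintegral_mul_le (hF k hk) hY).trans (ih (by omega)))
      refine lintegral_congr fun ω => ?_
      rw [Finset.sum_range_succ, Real.exp_add, ENNReal.ofReal_mul (Real.exp_pos _).le]
  have hmeas : AEMeasurable
      (fun ω => ENNReal.ofReal (Real.exp (∑ s ∈ Finset.range n, D s ω))) P := by
    simp_rw [Real.exp_sum, ENNReal.ofReal_prod_of_nonneg fun i _ => (Real.exp_pos _).le]
    exact (Finset.measurable_prod _ fun s hs => (hD s (Finset.mem_range.1 hs)).1).aemeasurable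
  have hpos : ENNReal.ofReal (Real.exp a) ≠ 0 := by simp [Real.exp_pos]
  calc P {ω | a ≤ ∑ s ∈ Finset.range n, D s ω}
      ≤ P {ω | ENNReal.ofReal (Real.exp a) ≤
          ENNReal.ofReal (Real.exp (∑ s ∈ Finset.range n, D s ω))} := by
        refine measure_mono fun ω hω => ?_
        exact ENNReal.ofReal_le_ofReal (Real.exp_le_exp.2 hω)
    _ ≤ (∫⁻ ω, ENNReal.ofReal (Real.exp (∑ s ∈ Finset.range n, D s ω)) ∂P) /
          ENNReal.ofReal (Real.exp a) :=
        meas_ge_le_lintegral_div hmeas hpos ENNReal.ofReal_ne_top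
    _ ≤ 1 / ENNReal.ofReal (Real.exp a) := ENNReal.div_le_div_right (key n le_rfl) _
    _ = ENNReal.ofReal (Real.exp (-a)) := by
        rw [one_div, Real.exp_neg, ENNReal.ofReal_inv_of_pos (Real.exp_pos a)]

theorem CondSubGaussian.condExpLeOne [IsProbabilityMeasure P] {Z : Ω → ℝ} (hm : m ≤ mΩ)
    (hZ : Measurable Z) (h : CondSubGaussian P m Z) (l : ℝ) :
    CondExpLeOne P m fun ω => ENNReal.ofReal (Real.exp (l * Z ω - l ^ 2 / 2)) := by
  refine ⟨by fun_prop, fun S hS => ?_⟩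
  obtain ⟨hint, hle⟩ := h l
  have h1 : ∫ ω in S, Real.exp (l * Z ω) ∂P ≤ Real.exp (l ^ 2 / 2) * P.real S := by
    rw [← setIntegral_condExp hm hint hS]
    calc ∫ ω in S, (P[fun ω => Real.exp (l * Z ω) | m]) ω ∂P
        ≤ ∫ _ in S, Real.exp (l ^ 2 / 2) ∂P := by
          refine setIntegral_mono_ae integrable_condExp.integrableOn
            (integrable_const _).integrableOn hle
      _ = Real.exp (l ^ 2 / 2) * P.real S := by simp [mul_comm]
  have h2 : ∫⁻ ω in S, ENNReal.ofReal (Real.exp (l * Z ω - l ^ 2 / 2)) ∂P =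
      ENNReal.ofReal (∫ ω in S, Real.exp (l * Z ω) * Real.exp (-(l ^ 2 / 2)) ∂P) := by
    rw [ofReal_integral_eq_lintegral_ofReal (hint.mul_const _).integrableOn
      (ae_of_all _ fun ω => by positivity)]
    simp_rw [← Real.exp_add, sub_eq_add_neg]
  rw [h2, integral_mul_const]
  calc ENNReal.ofReal ((∫ ω in S, Real.exp (l * Z ω) ∂P) * Real.exp (-(l ^ 2 / 2)))
      ≤ ENNReal.ofReal (P.real S) := by
        refine ENNReal.ofReal_le_ofReal ?_
        calc _ ≤ Real.exp (l ^ 2 / 2) * P.real S * Real.exp (-(l ^ 2 / 2)) := by gcongr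
          _ = P.real S := by rw [mul_right_comm, ← Real.exp_add]; simp
    _ = P S := by simp [measureReal_def]

/-- A Bernoulli variable `1_A` of success probability at least `p` satisfies
`E exp (p / 2 - 1_A) ≤ 1`, because `1 - p (1 - e⁻¹) ≤ 1 - p / 2 ≤ exp (-p / 2)`. -/
theorem condExpLeOne_exp_sub_indicator [IsProbabilityMeasure P] {A : Set Ω} [DecidablePred (· ∈ A)]
    (hm : m ≤ mΩ) (hA : MeasurableSet A) {p : ℝ} (hp : ENNReal.ofReal p ≤ P A)
    (hind : ∀ S, MeasurableSet[m] S → P (A ∩ S) = P A * P S) :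
    CondExpLeOne P m
      fun ω => ENNReal.ofReal (Real.exp (p / 2 - if ω ∈ A then (1 : ℝ) else 0)) := by
  have hmeas : Measurable fun ω => (if ω ∈ A then (1 : ℝ) else 0) :=
    Measurable.ite hA measurable_const measurable_const
  refine ⟨by fun_prop, fun S hS => ?_⟩
  have hS' := hm _ hS
  rw [← lintegral_inter_add_sdiff _ _ hA]
  have e1 : ∫⁻ ω in S ∩ A, ENNReal.ofReal (Real.exp (p / 2 - if ω ∈ A then (1 : ℝ) else 0)) ∂P =
      ENNReal.ofReal (Real.exp (p / 2 - 1) * (P.real A * P.real S)) := by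
    rw [setLIntegral_congr_fun (g := fun _ => ENNReal.ofReal (Real.exp (p / 2 - 1))) (hS'.inter hA)
      fun ω hω => by simp [hω.2]]
    rw [setLIntegral_const, Set.inter_comm, hind S hS, ENNReal.ofReal_mul (Real.exp_pos _).le,
      ENNReal.ofReal_mul measureReal_nonneg]
    simp [measureReal_def]
  have e2 : ∫⁻ ω in S \ A, ENNReal.ofReal (Real.exp (p / 2 - if ω ∈ A then (1 : ℝ) else 0)) ∂P =
      ENNReal.ofReal (Real.exp (p / 2) * (P.real S - P.real A * P.real S)) := by
    rw [setLIntegral_congr_fun (g := fun _ => ENNReal.ofReal (Real.exp (p / 2))) (hS'.diff hA)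
      fun ω hω => by simp [hω.2]]
    have : P.real (S \ A) = P.real S - P.real A * P.real S := by
      have h1 := measureReal_inter_add_sdiff (μ := P) (s := S) hA
      have h2 : P.real (S ∩ A) = P.real A * P.real S := by
        rw [Set.inter_comm]; simp [measureReal_def, hind S hS]
      linarith
    rw [setLIntegral_const, ENNReal.ofReal_mul (Real.exp_pos _).le, ← this]
    simp [measureReal_def]
  have hpA : p ≤ P.real A := by
    rw [measureReal_def]
    exact (ENNReal.ofReal_le_iff_le_toReal (measure_ne_top _ _)).1 hp
  have hA1 : P.real A ≤ 1 := measureReal_le_one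
  have hS0 : 0 ≤ P.real S := measureReal_nonneg
  have hA0 : 0 ≤ P.real A := measureReal_nonneg
  have he : Real.exp (-1) ≤ 1 / 2 := by
    rw [Real.exp_neg, one_div]
    gcongr
    have := Real.add_one_le_exp (1 : ℝ)
    linarith
  rw [e1, e2, ← ENNReal.ofReal_add (by positivity)
    (mul_nonneg (Real.exp_pos _).le (by nlinarith))]
  calc _ ≤ ENNReal.ofReal (P.real S) := by
        refine ENNReal.ofReal_le_ofReal ?_
        have h3 : Real.exp (p / 2) * (1 - p / 2) ≤ 1 := by
          have := Real.add_one_le_exp (-(p / 2))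
          calc _ ≤ Real.exp (p / 2) * Real.exp (-(p / 2)) := by gcongr; linarith
            _ = 1 := by rw [← Real.exp_add]; simp
        have h4 : Real.exp (-1) * P.real A + (1 - P.real A) ≤ 1 - p / 2 := by nlinarith
        calc _ = Real.exp (p / 2) * (Real.exp (-1) * P.real A + (1 - P.real A)) * P.real S := by
              rw [sub_eq_add_neg, Real.exp_add]; ring
          _ ≤ Real.exp (p / 2) * (1 - p / 2) * P.real S := by gcongr
          _ ≤ 1 * P.real S := by gcongr
          _ = _ := one_mul _
    _ = P S := by simp [measureReal_def]

end Supermartingale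

/-! ### Measurability of the state of the algorithm -/

section Measurability

variable {A : Type*} {Ω : Type*}

/-- The feedback `f.1` with its reward replaced by the value at `ω` of the random variable `f.2`. -/
def fillReward (ω : Ω) (f : Feedback A × (Ω → ℝ)) : Feedback A := { f.1 with reward := f.2 ω }

/-- On the event `E` the random state `S` is constant but for the scheduled rewards, which are
`m`-measurable random variables. -/
def IsTemplateOn (m : MeasurableSpace Ω) (S : Ω → State A) (E : Set Ω) : Prop :=
  MeasurableSet[m] E ∧ ∃ (k : ℕ) (F : Finset A) (q : List A) (L : List (Feedback A × (Ω → ℝ))),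
    (∀ f ∈ L, Measurable[m] f.2) ∧ ∀ ω ∈ E, S ω = ⟨k, F, q, L.map (fillReward ω)⟩

/-- Measurability of a random state: countably many `m`-measurable events cover the event `E`, on
each of which the state is constant but for the `m`-measurable scheduled rewards. This avoids a
`σ`-algebra on states, which the arbitrary choices of the algorithm need not respect. -/
def StateMeasurableOn (m : MeasurableSpace Ω) (S : Ω → State A) (E : Set Ω) : Prop :=
  ∃ 𝓔 : Set (Set Ω), 𝓔.Countable ∧ (∀ E' ∈ 𝓔, IsTemplateOn m S E') ∧ E ⊆ ⋃₀ 𝓔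

theorem IsTemplateOn.stateMeasurableOn {m : MeasurableSpace Ω} {S : Ω → State A} {E : Set Ω}
    (h : IsTemplateOn m S E) : StateMeasurableOn m S E :=
  ⟨{E}, Set.countable_singleton E, by simpa using h, by simp⟩

theorem StateMeasurableOn.iUnion {m : MeasurableSpace Ω} {S : Ω → State A} {ι : Type*}
    [Countable ι] {E : ι → Set Ω} {E₀ : Set Ω} (h : ∀ i, StateMeasurableOn m S (E i))
    (hE : E₀ ⊆ ⋃ i, E i) : StateMeasurableOn m S E₀ := by
  choose 𝓔 hc ht hs using h
  refine ⟨⋃ i, 𝓔 i, Set.countable_iUnion hc, fun E' hE' => ?_, fun ω hω => ?_⟩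
  · obtain ⟨i, hi⟩ := Set.mem_iUnion.1 hE'
    exact ht i _ hi
  · obtain ⟨i, hi⟩ := Set.mem_iUnion.1 (hE hω)
    obtain ⟨E', hE', h'⟩ := hs i hi
    exact ⟨E', Set.mem_iUnion.2 ⟨i, hE'⟩, h'⟩

theorem measurableSet_of_stateMeasurableOn {m : MeasurableSpace Ω} {S₁ S₂ : Ω → State A}
    (h₁ : StateMeasurableOn m S₁ Set.univ) (h₂ : StateMeasurableOn m S₂ Set.univ)
    (g : ℕ → List A → ℕ → List A → Prop) :
    MeasurableSet[m] {ω | g (S₁ ω).phase (S₁ ω).queue (S₂ ω).phase (S₂ ω).queue} := by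
  obtain ⟨𝓔₁, hc₁, ht₁, hu₁⟩ := h₁
  obtain ⟨𝓔₂, hc₂, ht₂, hu₂⟩ := h₂
  have : {ω | g (S₁ ω).phase (S₁ ω).queue (S₂ ω).phase (S₂ ω).queue} =
      ⋃ E₁ ∈ 𝓔₁, ⋃ E₂ ∈ 𝓔₂,
        E₁ ∩ E₂ ∩ {ω | g (S₁ ω).phase (S₁ ω).queue (S₂ ω).phase (S₂ ω).queue} := by
    ext ω
    obtain ⟨E₁, hE₁, hω₁⟩ := hu₁ (Set.mem_univ ω)
    obtain ⟨E₂, hE₂, hω₂⟩ := hu₂ (Set.mem_univ ω)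
    simp only [Set.mem_iUnion, Set.mem_inter_iff, Set.mem_ofPred_eq]
    exact ⟨fun h => ⟨E₁, hE₁, E₂, hE₂, ⟨hω₁, hω₂⟩, h⟩, fun ⟨_, _, _, _, _, h⟩ => h⟩
  rw [this]
  refine MeasurableSet.biUnion hc₁ fun E₁ hE₁ => MeasurableSet.biUnion hc₂ fun E₂ hE₂ => ?_
  obtain ⟨hm₁, k₁, F₁, q₁, L₁, -, hS₁⟩ := ht₁ E₁ hE₁
  obtain ⟨hm₂, k₂, F₂, q₂, L₂, -, hS₂⟩ := ht₂ E₂ hE₂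
  by_cases hg : g k₁ q₁ k₂ q₂
  · convert hm₁.inter hm₂ using 1
    refine Set.inter_eq_left.2 fun ω hω => ?_
    simp only [Set.mem_ofPred_eq, hS₁ ω hω.1, hS₂ ω hω.2, hg]
  · convert MeasurableSet.empty using 1
    refine Set.eq_empty_of_forall_notMem fun ω hω => hg ?_
    have := hω.2
    simpa only [Set.mem_ofPred_eq, hS₁ ω hω.1.1, hS₂ ω hω.1.2] using this

open scoped Classical in
theorem observed_fillReward (L : List (Feedback A × (Ω → ℝ))) (ω : Ω) (t k : ℕ) (x : A) :
    observed (L.map (fillReward ω)) t k x =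
      (L.filter fun f => f.1.phase = k ∧ f.1.center = x ∧ f.1.arrival ≤ (t : ℕ∞)).map
        fun f => f.2 ω := by
  rw [observed, List.filter_map, List.map_map]
  rfl

theorem obsCount_fillReward (L : List (Feedback A × (Ω → ℝ))) (ω ω' : Ω) (t k : ℕ) (x : A) :
    obsCount (L.map (fillReward ω)) t k x = obsCount (L.map (fillReward ω')) t k x := by
  simp [obsCount, observed_fillReward]

theorem measurable_empMean_fillReward {m : MeasurableSpace Ω} {L : List (Feedback A × (Ω → ℝ))}
    (hL : ∀ f ∈ L, Measurable[m] f.2) (t k : ℕ) (x : A) :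
    Measurable[m] fun ω => empMean (L.map (fillReward ω)) t k x := by
  classical
  have h : (fun ω => empMean (L.map (fillReward ω)) t k x) = fun ω =>
      (((L.filter fun f => f.1.phase = k ∧ f.1.center = x ∧ f.1.arrival ≤ (t : ℕ∞)).map
        fun f => f.2).map fun f => f ω).sum /
      ((L.filter fun f => f.1.phase = k ∧ f.1.center = x ∧ f.1.arrival ≤ (t : ℕ∞)).length : ℝ) := by
    funext ω
    simp [empMean, obsCount, observed_fillReward, Function.comp_def]
  rw [h]
  refine Measurable.div_const ?_ _
  refine List.measurable_fun_sum _ fun f hf => ?_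
  obtain ⟨g, hg, rfl⟩ := List.mem_map.1 hf
  exact hL g (List.mem_filter.1 hg).1

theorem measurableSet_survivors_eq {m : MeasurableSpace Ω} {L : List (Feedback A × (Ω → ℝ))}
    (hL : ∀ f ∈ L, Measurable[m] f.2) (F G : Finset A) (t k : ℕ) :
    MeasurableSet[m] {ω | survivors F (L.map (fillReward ω)) t k = G} := by
  classical
  have hsurv : ∀ x, MeasurableSet[m] {ω | x ∈ survivors F (L.map (fillReward ω)) t k} := by
    intro x
    by_cases hx : x ∈ F
    · have : {ω | x ∈ survivors F (L.map (fillReward ω)) t k} = ⋂ y ∈ F,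
          {ω | empMean (L.map (fillReward ω)) t k y - empMean (L.map (fillReward ω)) t k x <
            4 * radius k} := by
        ext ω
        simp [survivors, hx]
      rw [this]
      refine MeasurableSet.biInter F.countable_toSet fun y _ => ?_
      exact measurableSet_lt ((measurable_empMean_fillReward hL t k y).sub
        (measurable_empMean_fillReward hL t k x)) measurable_const
    · simp [survivors, hx]
  by_cases hG : G ⊆ F
  · have : {ω | survivors F (L.map (fillReward ω)) t k = G} = ⋂ x ∈ F,
        {ω | x ∈ survivors F (L.map (fillReward ω)) t k ↔ x ∈ G} := by
      ext ω
      simp only [Set.mem_ofPred_eq, Set.mem_iInter]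
      refine ⟨fun h x _ => by rw [h], fun h => Finset.ext fun x => ?_⟩
      by_cases hx : x ∈ F
      · exact h x hx
      · exact ⟨fun h' => absurd (Finset.filter_subset _ _ h') hx, fun h' => absurd (hG h') hx⟩
    rw [this]
    refine MeasurableSet.biInter F.countable_toSet fun x _ => ?_
    by_cases hx : x ∈ G
    · simpa [hx] using hsurv x
    · simp only [hx, iff_false]
      exact (hsurv x).compl
  · convert MeasurableSet.empty using 1
    refine Set.eq_empty_of_forall_notMem fun ω hω => hG ?_
    rw [← (hω : survivors F (L.map (fillReward ω)) t k = G)]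
    exact Finset.filter_subset _ _

variable [MetricSpace A]

/-- A round preserves measurability: within a piece, split according to the delay of the new reward
and, at the end of a phase, to the set of surviving balls. -/
theorem StateMeasurableOn.step {m : MeasurableSpace Ω} {S : Ω → State A}
    (h : StateMeasurableOn m S Set.univ) (ch : Choices A) (T : ℕ) (δ : ℝ) (t : ℕ)
    {y : Ω → ℝ} {τ : Ω → ℕ∞} (hy : Measurable[m] y) (hτ : Measurable[m] τ) :
    StateMeasurableOn m (fun ω => step ch T δ t (y ω) (τ ω) (S ω)) Set.univ := by
  classical
  obtain ⟨𝓔, hc, ht, hu⟩ := h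
  have := hc.to_subtype
  refine StateMeasurableOn.iUnion (ι := 𝓔 × ℕ∞) (E := fun i => i.1.1 ∩ τ ⁻¹' {i.2}) ?_ ?_
  swap
  · intro ω hω
    obtain ⟨E, hE, hω'⟩ := hu hω
    exact Set.mem_iUnion.2 ⟨(⟨E, hE⟩, τ ω), hω', rfl⟩
  rintro ⟨⟨E, hE⟩, n⟩
  obtain ⟨hEm, k, F, q, L, hL, hS⟩ := ht E hE
  have hEn : MeasurableSet[m] (E ∩ τ ⁻¹' {n}) := hEm.inter (hτ (MeasurableSet.of_discrete))
  rcases q with _ | ⟨z, rest⟩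
  · refine IsTemplateOn.stateMeasurableOn ⟨hEn, k, F, [], L, hL, fun ω hω => ?_⟩
    simp [DelayedLipschitz.step, hS ω hω.1]
  rcases (E ∩ τ ⁻¹' {n}).eq_empty_or_nonempty with hemp | ⟨ω₀, hω₀⟩
  · exact ⟨∅, Set.countable_empty, by simp, by simp [hemp]⟩
  set L' : List (Feedback A × (Ω → ℝ)) := (⟨k, z, (t : ℕ∞) + n, 0⟩, y) :: L with hL'def
  have hL' : ∀ f ∈ L', Measurable[m] f.2 := by
    intro f hf
    rcases List.mem_cons.1 hf with rfl | hf
    · exact hy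
    · exact hL f hf
  set active : Finset A := F.filter
    fun x => (obsCount (L'.map (fillReward ω₀)) t k x : ℝ) < threshold T δ k with hact
  have hactive : ∀ ω, F.filter
      (fun x => (obsCount (L'.map (fillReward ω)) t k x : ℝ) < threshold T δ k) = active := by
    intro ω
    rw [hact]
    congr 1
    funext x
    rw [obsCount_fillReward L' ω ω₀]
  have hstep : ∀ ω ∈ E ∩ τ ⁻¹' {n}, DelayedLipschitz.step ch T δ t (y ω) (τ ω) (S ω) =
      if rest.filter (fun x => x ∈ active) ≠ [] then
        ⟨k, F, rest.filter (fun x => x ∈ active), L'.map (fillReward ω)⟩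
      else if active.Nonempty then ⟨k, F, ch.enum active, L'.map (fillReward ω)⟩
      else nextPhase ch t ⟨k, F, z :: rest, L.map (fillReward ω)⟩ (L'.map (fillReward ω)) := by
    intro ω hω
    have hn : τ ω = n := hω.2
    rw [hS ω hω.1, ← hactive ω, hn]
    rfl
  by_cases h1 : rest.filter (fun x => x ∈ active) ≠ []
  · exact IsTemplateOn.stateMeasurableOn
      ⟨hEn, _, _, _, L', hL', fun ω hω => (hstep ω hω).trans (if_pos h1)⟩
  by_cases h2 : active.Nonempty
  · exact IsTemplateOn.stateMeasurableOn
      ⟨hEn, _, _, _, L', hL', fun ω hω =>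
        (hstep ω hω).trans ((if_neg h1).trans (if_pos h2))⟩
  refine StateMeasurableOn.iUnion (ι := F.powerset)
    (E := fun G => E ∩ τ ⁻¹' {n} ∩ {ω | survivors F (L'.map (fillReward ω)) t k = G}) ?_ ?_
  · rintro ⟨G, hG⟩
    refine IsTemplateOn.stateMeasurableOn
      ⟨hEn.inter (measurableSet_survivors_eq hL' F G t k), k + 1,
        ch.cover (⋃ x ∈ G, Metric.closedBall x (radius k)) (radius k / 2),
        ch.enum (ch.cover (⋃ x ∈ G, Metric.closedBall x (radius k)) (radius k / 2)), L', hL',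
        fun ω hω => ?_⟩
    have hG' : survivors F (L'.map (fillReward ω)) t k = G := hω.2
    refine (hstep ω hω.1).trans ((if_neg h1).trans ((if_neg h2).trans ?_))
    simp only [nextPhase, hG']
  · intro ω hω
    refine Set.mem_iUnion.2 ⟨⟨survivors F (L'.map (fillReward ω)) t k, ?_⟩, hω, rfl⟩
    exact Finset.mem_powerset.2 (Finset.filter_subset _ _)

/-- The state at the beginning of round `t` is measurable in the earlier rewards and delays. -/
theorem stateMeasurableOn_state {m : MeasurableSpace Ω} (ch : Choices A) (T : ℕ) (δ : ℝ)
    {y : ℕ → Ω → ℝ} {τ : ℕ → Ω → ℕ∞} (t : ℕ) (hy : ∀ s < t, Measurable[m] (y s))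
    (hτ : ∀ s < t, Measurable[m] (τ s)) :
    StateMeasurableOn m (fun ω => state ch T δ (fun s => y s ω) (fun s => τ s ω) t) Set.univ := by
  induction t with
  | zero =>
    exact IsTemplateOn.stateMeasurableOn ⟨MeasurableSet.univ, _, _, _, [], by simp, fun ω _ => rfl⟩
  | succ t ih =>
    exact (ih (fun s hs => hy s (by omega)) fun s hs => hτ s (by omega)).step ch T δ t
      (hy t (by omega)) (hτ t (by omega))

end Measurability

/-! ### Round-robin play along a trajectory -/

section Trajectory

variable {A : Type*}

/-- In round `s` of the trajectory `st`, the ball of phase `k` with centre `x` is played. -/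
def IsPlay (st : ℕ → State A) (k : ℕ) (x : A) (s : ℕ) : Prop :=
  (st s).phase = k ∧ (st s).queue.head? = some x

open scoped Classical in
/-- The rounds before round `t` in which the ball of phase `k` with centre `x` is played. -/
noncomputable def plays (st : ℕ → State A) (k : ℕ) (x : A) (t : ℕ) : Finset ℕ :=
  (Finset.range t).filter (IsPlay st k x)

open scoped Classical in
/-- The plays of a ball whose rewards are observed before round `t`. -/
noncomputable def observedPlays (st : ℕ → State A) (τ : ℕ → ℕ∞) (k : ℕ) (x : A) (t : ℕ) :
    Finset ℕ :=
  (Finset.range t).filter fun s => IsPlay st k x s ∧ (s : ℕ∞) + τ s < t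

theorem mem_plays {st : ℕ → State A} {k : ℕ} {x : A} {t s : ℕ} :
    s ∈ plays st k x t ↔ s < t ∧ IsPlay st k x s := by simp [plays]

theorem mem_observedPlays {st : ℕ → State A} {τ : ℕ → ℕ∞} {k : ℕ} {x : A} {t s : ℕ} :
    s ∈ observedPlays st τ k x t ↔ s < t ∧ IsPlay st k x s ∧ (s : ℕ∞) + τ s < t := by
  simp [observedPlays]

theorem filter_plays_le (st : ℕ → State A) (τ : ℕ → ℕ∞) (k : ℕ) (x : A) (t : ℕ) :
    ((plays st k x (t + 1)).filter fun s : ℕ => (s : ℕ∞) + τ s ≤ t) =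
      observedPlays st τ k x (t + 1) := by
  ext s
  have : ((t + 1 : ℕ) : ℕ∞) = (t : ℕ∞) + 1 := by push_cast; rfl
  rw [Finset.mem_filter, mem_plays, mem_observedPlays, this,
    ENat.lt_add_one_iff (ENat.natCast_ne_top t), and_assoc]

theorem observedPlays_mono {st : ℕ → State A} {τ : ℕ → ℕ∞} {k : ℕ} {x : A} {t t' : ℕ}
    (h : t ≤ t') : observedPlays st τ k x t ⊆ observedPlays st τ k x t' := by
  intro s hs
  rw [mem_observedPlays] at hs ⊢
  exact ⟨by omega, hs.2.1, hs.2.2.trans_le (by exact_mod_cast h)⟩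

theorem card_plays_succ_of_isPlay {st : ℕ → State A} {k : ℕ} {x : A} {t : ℕ}
    (h : IsPlay st k x t) : (plays st k x (t + 1)).card = (plays st k x t).card + 1 := by
  rw [plays, Finset.range_add_one, Finset.filter_insert, if_pos h, Finset.card_insert_of_notMem]
  · rfl
  · simp

theorem plays_succ_of_not_isPlay {st : ℕ → State A} {k : ℕ} {x : A} {t : ℕ}
    (h : ¬ IsPlay st k x t) : plays st k x (t + 1) = plays st k x t := by
  rw [plays, Finset.range_add_one, Finset.filter_insert, if_neg h]
  rfl

/-- Rounds `s` and `s₀` play the same ball. -/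
def SamePlay (st : ℕ → State A) (s₀ s : ℕ) : Prop :=
  (st s).phase = (st s₀).phase ∧ (st s).queue.head? = (st s₀).queue.head?

theorem IsPlay.samePlay_iff {st : ℕ → State A} {k : ℕ} {x : A} {s₀ s : ℕ}
    (h : IsPlay st k x s₀) : SamePlay st s₀ s ↔ IsPlay st k x s := by
  rw [SamePlay, IsPlay, h.1, h.2]

open scoped Classical in
/-- The delays behave as expected: whenever a ball has been played `n` times since its first play,
the number of these plays of delay at most `q` is at least `p n / 2 - ℓ`. -/
def DelayGood (st : ℕ → State A) (τ : ℕ → ℕ∞) (T q : ℕ) (p ℓ : ℝ) : Prop :=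
  ∀ s₀ u, s₀ ≤ u → u < T →
    p / 2 * ((Finset.range (u + 1)).filter fun s => s₀ ≤ s ∧ SamePlay st s₀ s).card -
      ((Finset.range (u + 1)).filter fun s => (s₀ ≤ s ∧ SamePlay st s₀ s) ∧ τ s ≤ q).card < ℓ

variable [MetricSpace A] (ch : Choices A) (T : ℕ) (δ : ℝ) (y : ℕ → ℝ) (τ : ℕ → ℕ∞)

theorem state_succ_scheduled {t : ℕ} {z : A} {rest : List A}
    (hz : (state ch T δ y τ t).queue = z :: rest) :
    (state ch T δ y τ (t + 1)).scheduled =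
      ⟨(state ch T δ y τ t).phase, z, (t : ℕ∞) + τ t, y t⟩ ::
        (state ch T δ y τ t).scheduled := by
  rw [state, step]
  simp only [hz, nextPhase]
  split_ifs <;> rfl

/-- The scheduled rewards are those of the earlier plays. -/
theorem observed_scheduled (u k : ℕ) (x : A) (t : ℕ)
    (hq : ∀ s < t, (state ch T δ y τ s).queue ≠ []) :
    obsCount (state ch T δ y τ t).scheduled u k x =
        ((plays (state ch T δ y τ) k x t).filter fun s : ℕ => (s : ℕ∞) + τ s ≤ u).card ∧
      (observed (state ch T δ y τ t).scheduled u k x).sum =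
        ∑ s ∈ (plays (state ch T δ y τ) k x t).filter fun s : ℕ => (s : ℕ∞) + τ s ≤ u, y s := by
  classical
  induction t with
  | zero => simp [state, init, obsCount, observed, plays]
  | succ t ih =>
    obtain ⟨ih₁, ih₂⟩ := ih fun s hs => hq s (by omega)
    obtain ⟨z, rest, hz⟩ := List.exists_cons_of_ne_nil (hq t (by omega))
    have hp : ∀ x, IsPlay (state ch T δ y τ) k x t ↔
        ((state ch T δ y τ t).phase = k ∧ z = x) := by simp [IsPlay, hz]
    simp only [obsCount, observed] at ih₁ ih₂ ⊢
    rw [state_succ_scheduled ch T δ y τ hz]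
    have hins : plays (state ch T δ y τ) k x (t + 1) =
        if IsPlay (state ch T δ y τ) k x t then insert t (plays (state ch T δ y τ) k x t)
        else plays (state ch T δ y τ) k x t := by
      simp only [plays, Finset.range_add_one, Finset.filter_insert]
    have hnot : t ∉ (plays (state ch T δ y τ) k x t).filter fun s : ℕ => (s : ℕ∞) + τ s ≤ u := by
      simp [mem_plays]
    by_cases h : (state ch T δ y τ t).phase = k ∧ z = x
    · by_cases hu : (t : ℕ∞) + τ t ≤ u
      · rw [List.filter_cons_of_pos (by simpa using ⟨h.1, h.2, hu⟩), hins, if_pos ((hp x).2 h),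
          Finset.filter_insert, if_pos hu, Finset.card_insert_of_notMem hnot,
          Finset.sum_insert hnot, List.map_cons, List.length_cons, List.sum_cons, ih₁, ih₂]
        exact ⟨rfl, rfl⟩
      · rw [List.filter_cons_of_neg (by simpa using fun _ _ => not_le.1 hu), hins,
          if_pos ((hp x).2 h), Finset.filter_insert, if_neg hu, ih₁, ih₂]
        exact ⟨rfl, rfl⟩
    · rw [List.filter_cons_of_neg (by simpa using fun h₁ h₂ => absurd ⟨h₁, h₂⟩ h), hins,
        if_neg (fun h' => h ((hp x).1 h')), ih₁, ih₂]
      exact ⟨rfl, rfl⟩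

theorem obsCount_scheduled_succ (k : ℕ) (x : A) (t : ℕ)
    (hq : ∀ s < t + 1, (state ch T δ y τ s).queue ≠ []) :
    obsCount (state ch T δ y τ (t + 1)).scheduled t k x =
      (observedPlays (state ch T δ y τ) τ k x (t + 1)).card := by
  rw [(observed_scheduled ch T δ y τ t k x (t + 1) hq).1, filter_plays_le]

theorem empMean_scheduled_succ (k : ℕ) (x : A) (t : ℕ)
    (hq : ∀ s < t + 1, (state ch T δ y τ s).queue ≠ []) :
    empMean (state ch T δ y τ (t + 1)).scheduled t k x =
      (∑ s ∈ observedPlays (state ch T δ y τ) τ k x (t + 1), y s) /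
        (observedPlays (state ch T δ y τ) τ k x (t + 1)).card := by
  rw [empMean, obsCount_scheduled_succ ch T δ y τ k x t hq,
    (observed_scheduled ch T δ y τ t k x (t + 1) hq).2, filter_plays_le]

open scoped Classical in
/-- The centres of the balls of the current phase of round `t` that are still active at the end of
round `t`. -/
noncomputable def stillActive (t : ℕ) : Finset A :=
  (state ch T δ y τ t).centers.filter fun x =>
    ((observedPlays (state ch T δ y τ) τ (state ch T δ y τ t).phase x (t + 1)).card : ℝ) <
      threshold T δ (state ch T δ y τ t).phase

theorem mem_stillActive {t : ℕ} {x : A} : x ∈ stillActive ch T δ y τ t ↔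
    x ∈ (state ch T δ y τ t).centers ∧
    ((observedPlays (state ch T δ y τ) τ (state ch T δ y τ t).phase x (t + 1)).card : ℝ) <
      threshold T δ (state ch T δ y τ t).phase := by
  simp [stillActive]

open scoped Classical in
/-- The three possible outcomes of a round: the pass continues, a new pass begins, or a new phase
begins. -/
theorem state_succ_cases {t : ℕ} {z : A} {rest : List A}
    (hq : ∀ s < t + 1, (state ch T δ y τ s).queue ≠ [])
    (hz : (state ch T δ y τ t).queue = z :: rest) :
    ((state ch T δ y τ (t + 1)).phase = (state ch T δ y τ t).phase ∧
      (state ch T δ y τ (t + 1)).centers = (state ch T δ y τ t).centers ∧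
      ((state ch T δ y τ (t + 1)).queue = rest.filter (fun x => x ∈ stillActive ch T δ y τ t) ∨
        rest.filter (fun x => x ∈ stillActive ch T δ y τ t) = [] ∧
        (state ch T δ y τ (t + 1)).queue = ch.enum (stillActive ch T δ y τ t))) ∨
    (stillActive ch T δ y τ t = ∅ ∧ state ch T δ y τ (t + 1) =
      nextPhase ch t (state ch T δ y τ t) (state ch T δ y τ (t + 1)).scheduled) := by
  have hact : (state ch T δ y τ t).centers.filter (fun x =>
      (obsCount (⟨(state ch T δ y τ t).phase, z, (t : ℕ∞) + τ t, y t⟩ ::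
        (state ch T δ y τ t).scheduled) t (state ch T δ y τ t).phase x : ℝ) <
        threshold T δ (state ch T δ y τ t).phase) = stillActive ch T δ y τ t := by
    rw [stillActive]
    congr 1
    funext x
    rw [← state_succ_scheduled ch T δ y τ hz, obsCount_scheduled_succ ch T δ y τ _ x t hq]
  have hst : state ch T δ y τ (t + 1) =
      if rest.filter (fun x => x ∈ stillActive ch T δ y τ t) ≠ [] then
        { state ch T δ y τ t with
          queue := rest.filter (fun x => x ∈ stillActive ch T δ y τ t)
          scheduled := (state ch T δ y τ (t + 1)).scheduled }
      else if (stillActive ch T δ y τ t).Nonempty then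
        { state ch T δ y τ t with
          queue := ch.enum (stillActive ch T δ y τ t)
          scheduled := (state ch T δ y τ (t + 1)).scheduled }
      else nextPhase ch t (state ch T δ y τ t) (state ch T δ y τ (t + 1)).scheduled := by
    rw [state_succ_scheduled ch T δ y τ hz, ← hact, state, step]
    simp only [hz]
  by_cases h1 : rest.filter (fun x => x ∈ stillActive ch T δ y τ t) ≠ []
  · rw [if_pos h1] at hst
    left
    rw [hst]
    exact ⟨rfl, rfl, Or.inl rfl⟩
  rw [if_neg h1] at hst
  by_cases h2 : (stillActive ch T δ y τ t).Nonempty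
  · rw [if_pos h2] at hst
    left
    rw [hst]
    exact ⟨rfl, rfl, Or.inr ⟨not_not.1 h1, rfl⟩⟩
  · rw [if_neg h2] at hst
    exact Or.inr ⟨Finset.not_nonempty_iff_eq_empty.1 h2, hst⟩

theorem phase_succ (t : ℕ) :
    (state ch T δ y τ (t + 1)).phase = (state ch T δ y τ t).phase + 1 ∨
    (state ch T δ y τ (t + 1)).phase = (state ch T δ y τ t).phase ∧
      (state ch T δ y τ (t + 1)).centers = (state ch T δ y τ t).centers := by
  rw [state, step]
  rcases (state ch T δ y τ t).queue with _ | ⟨z, rest⟩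
  · simp
  · dsimp only
    split_ifs <;> simp [nextPhase]

theorem phase_monotone : Monotone fun t => (state ch T δ y τ t).phase :=
  monotone_nat_of_le_succ fun t => by rcases phase_succ ch T δ y τ t with h | h <;> omega

theorem one_le_phase (t : ℕ) : 1 ≤ (state ch T δ y τ t).phase :=
  phase_monotone ch T δ y τ (Nat.zero_le t)

theorem centers_eq_of_phase_eq {s t : ℕ} (hst : s ≤ t)
    (h : (state ch T δ y τ s).phase = (state ch T δ y τ t).phase) :
    (state ch T δ y τ s).centers = (state ch T δ y τ t).centers := by
  induction t with
  | zero => obtain rfl : s = 0 := by omega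
            rfl
  | succ t ih =>
    rcases Nat.lt_or_ge t s with h' | h'
    · obtain rfl : s = t + 1 := by omega
      rfl
    · have h1 := phase_monotone ch T δ y τ h'
      dsimp only at h1
      rcases phase_succ ch T δ y τ t with h2 | h2
      · omega
      · rw [h2.2, ih h' (by omega)]

/-- The round-robin invariant at the beginning of round `t`: in the current pass, number `j`, the
balls in the queue have been played `j` times, no ball has been played more than `j + 1` times, and
active balls outside the queue have had their turn already. -/
structure RoundRobin (t j : ℕ) : Prop where
  nodup : (state ch T δ y τ t).queue.Nodup
  mem_centers : ∀ x ∈ (state ch T δ y τ t).queue, x ∈ (state ch T δ y τ t).centers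
  active : ∀ x ∈ (state ch T δ y τ t).queue,
    ((observedPlays (state ch T δ y τ) τ (state ch T δ y τ t).phase x t).card : ℝ) <
      threshold T δ (state ch T δ y τ t).phase
  card_queue : ∀ x ∈ (state ch T δ y τ t).queue,
    (plays (state ch T δ y τ) (state ch T δ y τ t).phase x t).card = j
  card_le : ∀ x, (plays (state ch T δ y τ) (state ch T δ y τ t).phase x t).card ≤ j + 1
  card_active : ∀ x ∈ (state ch T δ y τ t).centers, x ∉ (state ch T δ y τ t).queue →
    ((observedPlays (state ch T δ y τ) τ (state ch T δ y τ t).phase x t).card : ℝ) <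
      threshold T δ (state ch T δ y τ t).phase →
    (plays (state ch T δ y τ) (state ch T δ y τ t).phase x t).card = j + 1

theorem exists_roundRobin (hthr : ∀ k, 0 < threshold T δ k) (t : ℕ)
    (hq : ∀ s < t, (state ch T δ y τ s).queue ≠ []) : ∃ j, RoundRobin ch T δ y τ t j := by
  classical
  induction t with
  | zero =>
    refine ⟨0, ch.nodup_enum _, fun x hx => (ch.mem_enum _ _).1 hx, fun x _ => ?_, fun x _ => ?_,
      fun x => ?_, fun x hx hx' _ => absurd ((ch.mem_enum _ _).2 hx) hx'⟩
    · simpa [observedPlays] using hthr _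
    · simp [plays]
    · simp [plays]
  | succ t ih =>
    obtain ⟨j, hj⟩ := ih fun s hs => hq s (by omega)
    obtain ⟨z, rest, hz⟩ := List.exists_cons_of_ne_nil (hq t (by omega))
    have hnodup : z ∉ rest ∧ rest.Nodup := by simpa [hz] using hj.nodup
    rcases state_succ_cases ch T δ y τ hq hz with ⟨hph, hcen, hcase⟩ | ⟨-, hnext⟩
    · have hzplay : IsPlay (state ch T δ y τ) (state ch T δ y τ t).phase z t := by
        simp [IsPlay, hz]
      have hzcard := card_plays_succ_of_isPlay hzplay
      rw [hj.card_queue z (by simp [hz])] at hzcard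
      have hother : ∀ x, x ≠ z → plays (state ch T δ y τ) (state ch T δ y τ t).phase x (t + 1) =
          plays (state ch T δ y τ) (state ch T δ y τ t).phase x t := by
        intro x hx
        refine plays_succ_of_not_isPlay fun h => hx ?_
        have := h.2
        rw [hz] at this
        simpa using this.symm
      have hle : ∀ x,
          (plays (state ch T δ y τ) (state ch T δ y τ t).phase x (t + 1)).card ≤ j + 1 := by
        intro x
        by_cases hx : x = z
        · rw [hx, hzcard]
        · rw [hother x hx]
          exact hj.card_le x
      -- an active ball which is not in the rest of the queue has completed the current pass
      have hdone : ∀ x ∈ stillActive ch T δ y τ t, x ∉ rest →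
          (plays (state ch T δ y τ) (state ch T δ y τ t).phase x (t + 1)).card = j + 1 := by
        intro x hx hxr
        rw [mem_stillActive] at hx
        by_cases hxz : x = z
        · rw [hxz, hzcard]
        · rw [hother x hxz]
          refine hj.card_active x hx.1 (by simp [hz, hxz, hxr]) (lt_of_le_of_lt ?_ hx.2)
          exact Nat.cast_le.2 (Finset.card_le_card (observedPlays_mono (Nat.le_succ t)))
      rcases hcase with hqueue | ⟨hempty, hqueue⟩
      · refine ⟨j, ?_, ?_, ?_, ?_, ?_, ?_⟩
        · rw [hqueue]
          exact hnodup.2.filter _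
        all_goals try rw [hph]
        all_goals try rw [hqueue]
        all_goals try rw [hcen]
        · intro x hx
          exact hj.mem_centers x (by rw [hz]; exact List.mem_cons_of_mem _ (List.mem_filter.1 hx).1)
        · intro x hx
          have := (List.mem_filter.1 hx).2
          exact ((mem_stillActive ch T δ y τ).1 (by simpa using this)).2
        · intro x hx
          have hxr := (List.mem_filter.1 hx).1
          rw [hother x (fun h => hnodup.1 (h ▸ hxr))]
          exact hj.card_queue x (by rw [hz]; exact List.mem_cons_of_mem _ hxr)
        · exact hle
        · intro x hx hxq hxa
          have hxact : x ∈ stillActive ch T δ y τ t := (mem_stillActive ch T δ y τ).2 ⟨hx, hxa⟩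
          exact hdone x hxact fun hxr => hxq (List.mem_filter.2 ⟨hxr, by simpa using hxact⟩)
      · refine ⟨j + 1, ?_, ?_, ?_, ?_, ?_, ?_⟩
        · rw [hqueue]
          exact ch.nodup_enum _
        all_goals try rw [hph]
        all_goals try rw [hqueue]
        all_goals try rw [hcen]
        · intro x hx
          exact ((mem_stillActive ch T δ y τ).1 ((ch.mem_enum _ _).1 hx)).1
        · intro x hx
          exact ((mem_stillActive ch T δ y τ).1 ((ch.mem_enum _ _).1 hx)).2
        · intro x hx
          rw [ch.mem_enum] at hx
          refine hdone x hx fun hxr => ?_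
          have : x ∈ rest.filter (fun x => x ∈ stillActive ch T δ y τ t) :=
            List.mem_filter.2 ⟨hxr, by simpa using hx⟩
          simp [hempty] at this
        · exact fun x => (hle x).trans (by omega)
        · intro x hx hxq hxa
          exact absurd ((ch.mem_enum _ _).2 ((mem_stillActive ch T δ y τ).2 ⟨hx, hxa⟩)) hxq
    · have hph : (state ch T δ y τ (t + 1)).phase = (state ch T δ y τ t).phase + 1 := by
        rw [hnext]; rfl
      have hno : ∀ s < t + 1, ∀ x,
          ¬ IsPlay (state ch T δ y τ) (state ch T δ y τ (t + 1)).phase x s := by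
        intro s hs x h
        have h1 := phase_monotone ch T δ y τ (Nat.lt_succ_iff.1 hs)
        have h2 := h.1
        dsimp only at h1
        omega
      have hplays : ∀ x,
          plays (state ch T δ y τ) (state ch T δ y τ (t + 1)).phase x (t + 1) = ∅ :=
        fun x => Finset.filter_eq_empty_iff.2 fun s hs => hno s (Finset.mem_range.1 hs) x
      have hobs : ∀ x,
          observedPlays (state ch T δ y τ) τ (state ch T δ y τ (t + 1)).phase x (t + 1) = ∅ :=
        fun x => Finset.filter_eq_empty_iff.2 fun s hs h => hno s (Finset.mem_range.1 hs) x h.1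
      have hqc : (state ch T δ y τ (t + 1)).queue =
          ch.enum (state ch T δ y τ (t + 1)).centers := by rw [hnext]; rfl
      refine ⟨0, ?_, ?_, ?_, ?_, ?_, ?_⟩
      · rw [hqc]
        exact ch.nodup_enum _
      · intro x hx
        rw [hqc] at hx
        exact (ch.mem_enum _ _).1 hx
      · intro x _
        rw [hobs x]
        simpa using hthr _
      · intro x _
        rw [hplays x]
        rfl
      · intro x
        rw [hplays x]
        simp
      · intro x hx hxq
        rw [hqc] at hxq
        exact absurd ((ch.mem_enum _ _).2 hx) hxq

theorem RoundRobin.card_plays_le {t j : ℕ} (h : RoundRobin ch T δ y τ t j) (x : A) {z : A}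
    (hz : z ∈ (state ch T δ y τ t).centers)
    (hact : ((observedPlays (state ch T δ y τ) τ (state ch T δ y τ t).phase z t).card : ℝ) <
      threshold T δ (state ch T δ y τ t).phase) :
    (plays (state ch T δ y τ) (state ch T δ y τ t).phase x t).card ≤
      (plays (state ch T δ y τ) (state ch T δ y τ t).phase z t).card + 1 := by
  have h1 := h.card_le x
  by_cases hzq : z ∈ (state ch T δ y τ t).queue
  · rw [h.card_queue z hzq]
    exact h1
  · rw [h.card_active z hz hzq hact]
    omega

open scoped Classical in
theorem card_phase_le (t : ℕ) (hthr : ∀ k, 0 < threshold T δ k)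
    (hq : ∀ s < t, (state ch T δ y τ s).queue ≠ []) (n : ℕ)
    (hn : ∀ x, (plays (state ch T δ y τ) (state ch T δ y τ t).phase x t).card ≤ n) :
    ((Finset.range t).filter fun s =>
      (state ch T δ y τ s).phase = (state ch T δ y τ t).phase).card ≤
      (state ch T δ y τ t).centers.card * n := by
  refine le_trans (Finset.card_le_card (t := (state ch T δ y τ t).centers.biUnion
    fun x => plays (state ch T δ y τ) (state ch T δ y τ t).phase x t) ?_)
    (Finset.card_biUnion_le_card_mul _ _ _ fun x _ => hn x)
  intro s hs
  obtain ⟨hst, hph⟩ := Finset.mem_filter.1 hs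
  rw [Finset.mem_range] at hst
  obtain ⟨z, rest, hz⟩ := List.exists_cons_of_ne_nil (hq s hst)
  obtain ⟨j, hj⟩ := exists_roundRobin ch T δ y τ hthr s fun s' hs' => hq s' (by omega)
  refine Finset.mem_biUnion.2 ⟨z, ?_, mem_plays.2 ⟨hst, hph, by simp [hz]⟩⟩
  rw [← centers_eq_of_phase_eq ch T δ y τ hst.le hph]
  exact hj.mem_centers z (by simp [hz])

open scoped Classical in
/-- The length of a phase. The ball `z` played in round `t` has too few observations still, so it
cannot have been played much more often than `2 (v + ℓ) / p` times before round `t - q`; as balls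
are played in turn, the same holds of every other ball. The last `q` rounds count in full. -/
theorem card_phase_le_of_delayGood {q : ℕ} {p ℓ : ℝ} (hp : 0 < p) (hℓ : 0 ≤ ℓ)
    (hthr : ∀ k, 0 < threshold T δ k) (hgood : DelayGood (state ch T δ y τ) τ T q p ℓ)
    {t : ℕ} (ht : t < T) (hq : ∀ s ≤ t, (state ch T δ y τ s).queue ≠ []) :
    (((Finset.range (t + 1)).filter fun s =>
      (state ch T δ y τ s).phase = (state ch T δ y τ t).phase).card : ℝ) ≤
      (state ch T δ y τ t).centers.card *
        (2 * (threshold T δ (state ch T δ y τ t).phase + ℓ) / p + 1) + q + 1 := by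
  set k := (state ch T δ y τ t).phase with hk
  obtain ⟨z, rest, hz⟩ := List.exists_cons_of_ne_nil (hq t le_rfl)
  obtain ⟨j, hj⟩ := exists_roundRobin ch T δ y τ hthr t fun s hs => hq s hs.le
  have hzc := hj.mem_centers z (by simp [hz])
  have hza := hj.active z (by simp [hz])
  rw [← hk] at hza
  have hsplit : ((Finset.range (t + 1)).filter fun s => (state ch T δ y τ s).phase = k).card ≤
      ((Finset.range (t - q)).filter fun s => (state ch T δ y τ s).phase = k).card + (q + 1) := by
    have hsub : ((Finset.range (t + 1)).filter fun s => (state ch T δ y τ s).phase = k) ⊆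
        ((Finset.range (t - q)).filter fun s => (state ch T δ y τ s).phase = k) ∪
          Finset.Ico (t - q) (t + 1) := by
      intro s hs
      simp only [Finset.mem_filter, Finset.mem_range, Finset.mem_union, Finset.mem_Ico] at hs ⊢
      rcases lt_or_ge s (t - q) with h | h
      · exact Or.inl ⟨h, hs.2⟩
      · exact Or.inr ⟨h, hs.1⟩
    refine (Finset.card_le_card hsub).trans ((Finset.card_union_le _ _).trans ?_)
    rw [Nat.card_Ico]
    omega
  have hmain : (((Finset.range (t - q)).filter fun s => (state ch T δ y τ s).phase = k).card : ℝ) ≤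
      (state ch T δ y τ t).centers.card * (2 * (threshold T δ k + ℓ) / p + 1) := by
    by_cases hph : (state ch T δ y τ (t - q)).phase = k
    · have hcen := centers_eq_of_phase_eq ch T δ y τ (Nat.sub_le t q) (hph.trans hk)
      obtain ⟨j', hj'⟩ := exists_roundRobin ch T δ y τ hthr (t - q) fun s hs => hq s (by omega)
      have hza' : ((observedPlays (state ch T δ y τ) τ (state ch T δ y τ (t - q)).phase z
          (t - q)).card : ℝ) < threshold T δ (state ch T δ y τ (t - q)).phase := by
        rw [hph]
        refine lt_of_le_of_lt ?_ hza
        exact Nat.cast_le.2 (Finset.card_le_card (observedPlays_mono (Nat.sub_le t q)))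
      have h1 := card_phase_le ch T δ y τ (t - q) hthr (fun s hs => hq s (by omega)) _
        fun x => hj'.card_plays_le ch T δ y τ x (hcen ▸ hzc) hza'
      rw [hph, hcen] at h1
      refine le_trans (Nat.cast_le.2 h1) ?_
      push_cast
      have h2 : ((plays (state ch T δ y τ) k z (t - q)).card : ℝ) ≤
          2 * (threshold T δ k + ℓ) / p := by
        rcases (plays (state ch T δ y τ) k z (t - q)).eq_empty_or_nonempty with h | h
        · rw [h]
          have := hthr k
          simp only [Finset.card_empty, Nat.cast_zero]
          positivity
        · set s₀ := (plays (state ch T δ y τ) k z (t - q)).min' h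
          have hs₀ := mem_plays.1 (Finset.min'_mem _ h)
          have hg := hgood s₀ (t - q - 1) (by omega) (by omega)
          have hu : t - q - 1 + 1 = t - q := by omega
          rw [hu] at hg
          have e1 : ((Finset.range (t - q)).filter
              fun s => s₀ ≤ s ∧ SamePlay (state ch T δ y τ) s₀ s) =
              plays (state ch T δ y τ) k z (t - q) := by
            ext s
            rw [Finset.mem_filter, hs₀.2.samePlay_iff, Finset.mem_range, mem_plays]
            exact ⟨fun h => ⟨h.1, h.2.2⟩,
              fun h' => ⟨h'.1, Finset.min'_le _ _ (mem_plays.2 h'), h'.2⟩⟩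
          have e2 : ((Finset.range (t - q)).filter
              fun s => (s₀ ≤ s ∧ SamePlay (state ch T δ y τ) s₀ s) ∧ τ s ≤ q) ⊆
              observedPlays (state ch T δ y τ) τ k z t := by
            intro s hs
            rw [Finset.mem_filter, hs₀.2.samePlay_iff, Finset.mem_range] at hs
            refine mem_observedPlays.2 ⟨by omega, hs.2.1.2, ?_⟩
            calc (s : ℕ∞) + τ s ≤ (s : ℕ∞) + q := by gcongr; exact hs.2.2
              _ = ((s + q : ℕ) : ℕ∞) := by push_cast; rfl
              _ < t := by exact_mod_cast (by omega : s + q < t)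
          rw [e1] at hg
          have e3 : (((Finset.range (t - q)).filter
              fun s => (s₀ ≤ s ∧ SamePlay (state ch T δ y τ) s₀ s) ∧ τ s ≤ q).card : ℝ) ≤
              (observedPlays (state ch T δ y τ) τ k z t).card := by
            exact_mod_cast Finset.card_le_card e2
          rw [le_div_iff₀ hp]
          linarith
      gcongr
    · have : ((Finset.range (t - q)).filter fun s => (state ch T δ y τ s).phase = k) = ∅ := by
        refine Finset.filter_eq_empty_iff.2 fun s hs hsk => hph ?_
        have h1 := phase_monotone ch T δ y τ (Finset.mem_range.1 hs).le
        have h2 := phase_monotone ch T δ y τ (Nat.sub_le t q)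
        dsimp only at h1 h2
        omega
      rw [this]
      have := hthr k
      simp only [Finset.card_empty, Nat.cast_zero]
      positivity
  have hsplit' := (Nat.cast_le (α := ℝ)).2 hsplit
  push_cast at hsplit'
  linarith

end Trajectory

/-! ### Coverings and the optimality gap -/

section Covering

variable {A : Type*} [MetricSpace A]

theorem radius_pos (k : ℕ) : 0 < radius k := by unfold radius; positivity

theorem radius_le_one (k : ℕ) : radius k ≤ 1 := pow_le_one₀ (by norm_num) (by norm_num)

theorem radius_succ (k : ℕ) : radius (k + 1) = radius k / 2 := by
  unfold radius; rw [pow_succ]; ring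

theorem IsDoubling.one_le [Nonempty A] {N : ℕ} (h : IsDoubling A N) : 1 ≤ N := by
  obtain ⟨x⟩ := ‹Nonempty A›
  obtain ⟨F, hF, hc⟩ := h x 1 one_pos
  obtain ⟨z, hz, -⟩ := Set.mem_iUnion₂.1 (hc (Metric.mem_closedBall_self zero_le_one))
  exact (Finset.card_pos.2 ⟨z, hz⟩).trans_le hF

theorem isCover_toNNReal_iff {S C : Set A} {r : ℝ} (hr : 0 ≤ r) :
    Metric.IsCover r.toNNReal S C ↔ ∀ a ∈ S, ∃ x ∈ C, dist a x ≤ r := by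
  rw [Metric.isCover_iff_subset_iUnion_closedBall, Real.coe_toNNReal _ hr]
  simp [Set.subset_def]

theorem IsDoubling.externalCoveringNumber_half_le [Nonempty A] {N : ℕ} (h : IsDoubling A N)
    {r : ℝ} (hr : 0 < r) (S : Set A) :
    Metric.externalCoveringNumber (r / 2).toNNReal S ≤
      N * Metric.externalCoveringNumber r.toNNReal S := by
  classical
  by_cases htop : Metric.externalCoveringNumber r.toNNReal S = ⊤
  · rw [htop, ENat.mul_top (by exact_mod_cast (by have := h.one_le; omega))]
    exact le_top
  have : Nonempty {C : Set A // Metric.IsCover r.toNNReal S C} := ⟨⟨S, Metric.IsCover.rfl⟩⟩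
  obtain ⟨C, hC⟩ := ENat.exists_eq_iInf
    fun C : {C : Set A // Metric.IsCover r.toNNReal S C} => C.1.encard
  have hC' : C.1.encard = Metric.externalCoveringNumber r.toNNReal S := by
    rw [hC, Metric.externalCoveringNumber, iInf_subtype']
  have hfin : C.1.Finite := Set.encard_ne_top_iff.1 (hC' ▸ htop)
  choose F hF hcov using fun x => h x r hr
  have hcover : Metric.IsCover (r / 2).toNNReal S
      ((hfin.toFinset.biUnion F : Finset A) : Set A) := by
    rw [isCover_toNNReal_iff (by positivity)]
    intro a ha
    obtain ⟨x, hx, hax⟩ := (isCover_toNNReal_iff hr.le).1 C.2 a ha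
    obtain ⟨z, hz, haz⟩ := Set.mem_iUnion₂.1 (hcov x (Metric.mem_closedBall.2 hax))
    exact ⟨z, by simpa using ⟨x, hx, hz⟩, haz⟩
  calc _ ≤ ((hfin.toFinset.biUnion F : Finset A) : Set A).encard :=
        hcover.externalCoveringNumber_le_encard
    _ = ((hfin.toFinset.biUnion F).card : ℕ∞) := Set.encard_coe_eq_coe_finsetCard _
    _ ≤ ((hfin.toFinset.card * N : ℕ) : ℕ∞) := by
        exact_mod_cast Finset.card_biUnion_le_card_mul _ _ _ fun x _ => hF x
    _ = N * Metric.externalCoveringNumber r.toNNReal S := by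
        rw [← hC', hfin.encard_eq_coe_toFinset_card]
        push_cast
        ring

theorem IsDoubling.externalCoveringNumber_univ_le [Nonempty A] {N : ℕ} (h : IsDoubling A N)
    (hdiam : ∀ x y : A, dist x y ≤ 1) (k : ℕ) :
    Metric.externalCoveringNumber (radius k).toNNReal (Set.univ : Set A) ≤ ((N ^ k : ℕ) : ℕ∞) := by
  induction k with
  | zero =>
    obtain ⟨x⟩ := ‹Nonempty A›
    have : Metric.IsCover (radius 0).toNNReal Set.univ ({x} : Set A) := by
      rw [isCover_toNNReal_iff (radius_pos 0).le]
      exact fun a _ => ⟨x, rfl, by simpa [radius] using hdiam a x⟩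
    simpa using this.externalCoveringNumber_le_encard
  | succ k ih =>
    rw [radius_succ]
    refine (h.externalCoveringNumber_half_le (radius_pos k) _).trans ?_
    rw [pow_succ']
    push_cast at ih ⊢
    gcongr

theorem HasZoomingBound.one_le [Nonempty A] {μ : A → ℝ} {c d : ℝ} (h : HasZoomingBound μ c d)
    (hμ : ∀ x, μ x ∈ Set.Icc (0 : ℝ) 1) : 1 ≤ c := by
  obtain ⟨hc, -, hb⟩ := h
  have h1 := hb 1 one_pos le_rfl
  have h2 : 1 ≤ zoomingNumber μ 1 := by
    rw [Order.one_le_iff_pos, zoomingNumber, Metric.externalCoveringNumber_pos_iff]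
    obtain ⟨x⟩ := ‹Nonempty A›
    refine ⟨x, ?_⟩
    have : (⨆ y, μ y) ≤ 1 := ciSup_le fun y => (hμ y).2
    have := (hμ x).1
    simp only [Set.mem_ofPred_eq, gap]
    linarith
  have h3 : (1 : ℝ≥0∞) ≤ ENNReal.ofReal (c * 1 ^ (-d)) := le_trans (by exact_mod_cast h2) h1
  rw [Real.one_rpow, mul_one, ENNReal.one_le_ofReal] at h3
  exact h3

/-- A smallest cover of a set of points of gap at most `20 r_k` by balls of radius `r_k`: the
zooming number at scale `32 r_k` bounds the covers by balls of radius `2 r_k`, and the doubling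
property halves the radius. For `32 r_k > 1` a cover of the whole space is small enough. -/
theorem Choices.card_cover_le [Nonempty A] {N : ℕ} (h : IsDoubling A N)
    (hdiam : ∀ x y : A, dist x y ≤ 1) {μ : A → ℝ} (hμ : ∀ x, μ x ∈ Set.Icc (0 : ℝ) 1) {c d : ℝ}
    (hz : HasZoomingBound μ c d) (ch : Choices A) (k : ℕ) {S : Set A}
    (hS : ∀ a ∈ S, gap μ a ≤ 20 * radius k) :
    ((ch.cover S (radius k)).card : ℝ) ≤ N ^ 5 * (c * radius k ^ (-d)) := by
  have hr := radius_pos k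
  have hN : (1 : ℝ) ≤ N := by exact_mod_cast h.one_le
  have hc := hz.one_le hμ
  obtain ⟨-, hd, hb⟩ := hz
  have hone : 1 ≤ c * radius k ^ (-d) := by
    have := Real.one_le_rpow_of_pos_of_le_one_of_nonpos hr (radius_le_one k) (neg_nonpos.2 hd)
    nlinarith
  have hcard := ch.card_cover S (radius k) hr
  by_cases hk : 32 * radius k ≤ 1
  · have h1 : ((ch.cover S (radius k)).card : ℕ∞) ≤ N * zoomingNumber μ (32 * radius k) := by
      rw [hcard]
      have h2 := h.externalCoveringNumber_half_le (r := 2 * radius k) (by positivity) S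
      rw [show 2 * radius k / 2 = radius k by ring] at h2
      refine h2.trans ?_
      gcongr
      rw [zoomingNumber, show 32 * radius k / 16 = 2 * radius k by ring]
      refine Metric.externalCoveringNumber_mono_set fun a ha => ?_
      have := hS a ha
      simp only [Set.mem_ofPred_eq]
      linarith
    have h3 : ((ch.cover S (radius k)).card : ℝ≥0∞) ≤
        N * ENNReal.ofReal (c * (32 * radius k) ^ (-d)) := by
      calc ((ch.cover S (radius k)).card : ℝ≥0∞)
          = (((ch.cover S (radius k)).card : ℕ∞) : ℝ≥0∞) := by simp
        _ ≤ ((N * zoomingNumber μ (32 * radius k) : ℕ∞) : ℝ≥0∞) := by exact_mod_cast h1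
        _ = N * ((zoomingNumber μ (32 * radius k) : ℕ∞) : ℝ≥0∞) := by simp
        _ ≤ _ := by gcongr; exact hb _ (by positivity) hk
    have h4 : ((ch.cover S (radius k)).card : ℝ) ≤ N * (c * (32 * radius k) ^ (-d)) := by
      rw [← ENNReal.ofReal_natCast N, ← ENNReal.ofReal_mul (by positivity),
        ← ENNReal.ofReal_natCast] at h3
      exact (ENNReal.ofReal_le_ofReal_iff (by positivity)).1 h3
    refine h4.trans ?_
    have h5 : (32 * radius k) ^ (-d) ≤ radius k ^ (-d) :=
      Real.rpow_le_rpow_of_nonpos hr (by linarith) (neg_nonpos.2 hd)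
    have h6 : (N : ℝ) ≤ N ^ 5 := le_self_pow₀ hN (by norm_num)
    gcongr
  · have hk5 : k ≤ 5 := by
      by_contra hlt
      refine hk ?_
      have : radius k ≤ radius 5 := pow_le_pow_of_le_one (by norm_num) (by norm_num) (by omega)
      have h5 : radius 5 = 1 / 32 := by norm_num [radius]
      linarith
    have h1 : ((ch.cover S (radius k)).card : ℕ∞) ≤ ((N ^ k : ℕ) : ℕ∞) := by
      rw [hcard]
      exact (Metric.externalCoveringNumber_mono_set (Set.subset_univ S)).trans
        (h.externalCoveringNumber_univ_le hdiam k)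
    have h2 : ((ch.cover S (radius k)).card : ℝ) ≤ (N : ℝ) ^ k := by
      exact_mod_cast (Nat.cast_le.1 h1)
    have h3 : (N : ℝ) ^ k ≤ N ^ 5 := pow_le_pow_right₀ hN hk5
    calc _ ≤ (N : ℝ) ^ 5 * 1 := by linarith
      _ ≤ _ := by gcongr

/-- No ball of a smallest cover is superfluous. -/
theorem Choices.exists_mem_dist_le (ch : Choices A) {S : Set A} {r : ℝ} (hr : 0 < r) {x : A}
    (hx : x ∈ ch.cover S r) : ∃ a ∈ S, dist a x ≤ r := by
  classical
  by_contra! hfar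
  have hcover : Metric.IsCover r.toNNReal S (((ch.cover S r).erase x : Finset A) : Set A) := by
    rw [isCover_toNNReal_iff hr.le]
    intro a ha
    obtain ⟨z, hz, haz⟩ := (isCover_toNNReal_iff hr.le).1 (ch.isCover_cover S r hr) a ha
    refine ⟨z, ?_, haz⟩
    rw [Finset.mem_coe, Finset.mem_erase]
    refine ⟨?_, hz⟩
    rintro rfl
    exact (hfar a ha).not_ge haz
  have h1 := hcover.externalCoveringNumber_le_encard
  rw [← ch.card_cover S r hr, Set.encard_coe_eq_coe_finsetCard] at h1
  have h2 := Nat.cast_le.1 h1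
  rw [Finset.card_erase_of_mem hx] at h2
  have := Finset.card_pos.2 ⟨x, hx⟩
  omega

theorem gap_le_gap_add_dist {μ : A → ℝ} (hL : LipschitzWith 1 μ) (a b : A) :
    gap μ b ≤ gap μ a + dist a b := by
  have := hL.dist_le_mul a b
  rw [Real.dist_eq, NNReal.coe_one, one_mul] at this
  have := le_abs_self (μ a - μ b)
  simp only [gap]
  linarith

theorem exists_gap_eq [CompactSpace A] [Nonempty A] {μ : A → ℝ} (hL : LipschitzWith 1 μ) :
    ∃ a, ∀ x, gap μ x = μ a - μ x ∧ μ x ≤ μ a := by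
  obtain ⟨a, -, ha⟩ := isCompact_univ.exists_isMaxOn Set.univ_nonempty hL.continuous.continuousOn
  have ha' : ∀ x, μ x ≤ μ a := fun x => ha (Set.mem_univ x)
  have : (⨆ y, μ y) = μ a :=
    le_antisymm (ciSup_le ha') (le_ciSup ⟨μ a, Set.forall_mem_range.2 ha'⟩ a)
  exact ⟨a, fun x => ⟨by rw [gap, this], ha' x⟩⟩

end Covering

/-! ### The set of near-optimal arms shrinks from phase to phase -/

section Elimination

variable {A : Type*} (T : ℕ) (δ : ℝ) {X : ℕ → A} {ε : ℕ → ℝ} {τ : ℕ → ℕ∞}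

open scoped Classical in
/-- The noise is tame: for the plays of one ball, from some play on, whose rewards are observed by
the end of round `u`, the average of the noise is smaller than the radius of the ball as soon as
there are sufficiently many. -/
def NoiseGood (st : ℕ → State A) (ε : ℕ → ℝ) (τ : ℕ → ℕ∞) (T : ℕ) (δ : ℝ) : Prop :=
  ∀ u < T, ∀ s₀ < u,
    threshold T δ (st s₀).phase ≤ ((Finset.range (u + 1)).filter fun s : ℕ =>
      (s₀ ≤ s ∧ SamePlay st s₀ s) ∧ (s : ℕ∞) + τ s < (u + 1 : ℕ)).card →
    |∑ s ∈ (Finset.range (u + 1)).filter fun s : ℕ =>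
        (s₀ ≤ s ∧ SamePlay st s₀ s) ∧ (s : ℕ∞) + τ s < (u + 1 : ℕ), ε s| <
      ((Finset.range (u + 1)).filter fun s : ℕ =>
        (s₀ ≤ s ∧ SamePlay st s₀ s) ∧ (s : ℕ∞) + τ s < (u + 1 : ℕ)).card * radius (st s₀).phase

theorem NoiseGood.abs_sum_lt {st : ℕ → State A} (h : NoiseGood st ε τ T δ)
    (hthr : ∀ k, 1 < threshold T δ k) {t : ℕ} (ht : t < T) {k : ℕ} {x : A}
    (hn : threshold T δ k ≤ (observedPlays st τ k x (t + 1)).card) :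
    |∑ s ∈ observedPlays st τ k x (t + 1), ε s| <
      (observedPlays st τ k x (t + 1)).card * radius k := by
  classical
  have hcard : 1 < (observedPlays st τ k x (t + 1)).card := by
    exact_mod_cast (hthr k).trans_le hn
  have hne : (observedPlays st τ k x (t + 1)).Nonempty := Finset.card_pos.1 (by omega)
  set s₀ := (observedPlays st τ k x (t + 1)).min' hne
  have hs₀ := mem_observedPlays.1 (Finset.min'_mem _ hne)
  have hlt : s₀ < t := by
    obtain ⟨b, hb, hbne⟩ := Finset.exists_mem_ne hcard s₀
    have h1 := Finset.min'_le _ b hb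
    have h2 := (mem_observedPlays.1 hb).1
    change s₀ ≤ b at h1
    omega
  have e : ((Finset.range (t + 1)).filter fun s : ℕ =>
      (s₀ ≤ s ∧ SamePlay st s₀ s) ∧ (s : ℕ∞) + τ s < (t + 1 : ℕ)) =
      observedPlays st τ k x (t + 1) := by
    ext s
    rw [Finset.mem_filter, hs₀.2.1.samePlay_iff, Finset.mem_range, mem_observedPlays]
    exact ⟨fun h => ⟨h.1, h.2.1.2, h.2.2⟩,
      fun h' => ⟨h'.1, ⟨Finset.min'_le _ _ (mem_observedPlays.2 h'), h'.2.1⟩, h'.2.2⟩⟩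
  have := h t ht s₀ hlt
  rw [e, hs₀.2.1.1] at this
  exact this hn

variable [MetricSpace A] (ch : Choices A) {μ : A → ℝ}

/-- The run of the algorithm when the pulled arms are `X`, the noise is `ε` and the delays are
`τ`. -/
noncomputable abbrev trajectory (ch : Choices A) (T : ℕ) (δ : ℝ) (μ : A → ℝ) (X : ℕ → A)
    (ε : ℕ → ℝ) (τ : ℕ → ℕ∞) : ℕ → State A :=
  state ch T δ (fun s => μ (X s) + ε s) τ

/-- In every round some ball is played, and the pulled arm belongs to it. -/
def ArmsInBalls (st : ℕ → State A) (X : ℕ → A) (T : ℕ) : Prop :=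
  ∀ t < T, ∃ z, (st t).queue.head? = some z ∧ X t ∈ Metric.closedBall z (radius (st t).phase)

theorem ArmsInBalls.queue_ne_nil {st : ℕ → State A} (h : ArmsInBalls st X T) {t : ℕ}
    (ht : t < T) : (st t).queue ≠ [] := by
  obtain ⟨z, hz, -⟩ := h t ht
  intro h'
  simp [h'] at hz

theorem ArmsInBalls.mem_of_isPlay {st : ℕ → State A} (h : ArmsInBalls st X T) {t k : ℕ} {x : A}
    (ht : t < T) (hx : IsPlay st k x t) : X t ∈ Metric.closedBall x (radius k) := by
  obtain ⟨z, hz, hm⟩ := h t ht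
  have : z = x := by have := hx.2; rw [hz] at this; simpa using this
  rwa [this, hx.1] at hm

variable {ch T δ}

/-- An empirical mean based on sufficiently many observations lies between any two strict bounds
`b - r_k` and `b' + r_k` that come from bounds of the mean reward on the pulled arms. -/
theorem empMean_mem_Ioo (harm : ArmsInBalls (trajectory ch T δ μ X ε τ) X T)
    (hnoise : NoiseGood (trajectory ch T δ μ X ε τ) ε τ T δ) (hthr : ∀ k, 1 < threshold T δ k)
    {t : ℕ} (ht : t < T) {k : ℕ} {x : A}
    (hn : threshold T δ k ≤ (observedPlays (trajectory ch T δ μ X ε τ) τ k x (t + 1)).card)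
    {b b' : ℝ} (hb : ∀ a ∈ Metric.closedBall x (radius k), μ a ∈ Set.Icc b b') :
    empMean (trajectory ch T δ μ X ε τ (t + 1)).scheduled t k x ∈
      Set.Ioo (b - radius k) (b' + radius k) := by
  have habs := abs_lt.1 (hnoise.abs_sum_lt T δ hthr ht hn)
  rw [empMean_scheduled_succ ch T δ _ τ k x t fun s hs => harm.queue_ne_nil T (by omega)]
  set O := observedPlays (trajectory ch T δ μ X ε τ) τ k x (t + 1)
  have hpos : (0 : ℝ) < O.card := lt_trans one_pos ((hthr k).trans_le hn)
  have hμ : ∀ s ∈ O, μ (X s) ∈ Set.Icc b b' := fun s hs => by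
    have hs' := mem_observedPlays.1 hs
    exact hb _ (harm.mem_of_isPlay T (by omega) hs'.2.1)
  have h1 : O.card * b ≤ ∑ s ∈ O, μ (X s) := by
    simpa using Finset.card_nsmul_le_sum O (fun s => μ (X s)) b fun s hs => (hμ s hs).1
  have h2 : ∑ s ∈ O, μ (X s) ≤ O.card * b' := by
    simpa using Finset.sum_le_card_nsmul O (fun s => μ (X s)) b' fun s hs => (hμ s hs).2
  rw [Finset.sum_add_distrib]
  constructor
  · rw [lt_div_iff₀ hpos]
    linarith [habs.1]
  · rw [div_lt_iff₀ hpos]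
    linarith [habs.2]

/-- In every phase `k` the balls form a smallest cover of a set that contains the optimal arm `a`
and consists of arms of gap at most `20 r_k`. The ball of the optimal arm has an empirical mean
above `μ a - 3 r_k`, and no ball has one above `μ a + r_k`, so it survives; the other surviving
balls have an empirical mean above `μ a - 7 r_k`, and hence consist of arms of gap at most
`10 r_k = 20 r_{k+1}`. -/
theorem exists_centers_eq_cover (hL : LipschitzWith 1 μ) (hμ : ∀ x, μ x ∈ Set.Icc (0 : ℝ) 1)
    {a : A} (ha : ∀ x, gap μ x = μ a - μ x ∧ μ x ≤ μ a)
    (harm : ArmsInBalls (trajectory ch T δ μ X ε τ) X T)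
    (hnoise : NoiseGood (trajectory ch T δ μ X ε τ) ε τ T δ) (hthr : ∀ k, 1 < threshold T δ k)
    (t : ℕ) (ht : t ≤ T) :
    ∃ S : Set A, a ∈ S ∧ (∀ x ∈ S, gap μ x ≤ 20 * radius (trajectory ch T δ μ X ε τ t).phase) ∧
      (trajectory ch T δ μ X ε τ t).centers =
        ch.cover S (radius (trajectory ch T δ μ X ε τ t).phase) := by
  induction t with
  | zero =>
    refine ⟨Set.univ, Set.mem_univ a, fun x _ => ?_, rfl⟩
    have h1 : radius (trajectory ch T δ μ X ε τ 0).phase = 1 / 2 := by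
      simp [trajectory, state, init, radius]
    rw [h1, (ha x).1]
    linarith [(hμ a).2, (hμ x).1]
  | succ t ih =>
    obtain ⟨S, haS, hS, hcen⟩ := ih (by omega)
    have hq : ∀ s < t + 1, (trajectory ch T δ μ X ε τ s).queue ≠ [] :=
      fun s hs => harm.queue_ne_nil T (by omega)
    obtain ⟨z, rest, hz⟩ := List.exists_cons_of_ne_nil (hq t (by omega))
    rcases state_succ_cases ch T δ _ τ hq hz with ⟨hph, hcen', -⟩ | ⟨hact, hnext⟩
    · refine ⟨S, haS, ?_, ?_⟩
      · rw [hph]; exact hS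
      · rw [hph, hcen', hcen]
    · set k := (trajectory ch T δ μ X ε τ t).phase with hk
      set F := (trajectory ch T δ μ X ε τ t).centers with hF
      set L := (trajectory ch T δ μ X ε τ (t + 1)).scheduled with hLdef
      have hr := radius_pos k
      have hcount : ∀ x ∈ F, threshold T δ k ≤
          (observedPlays (trajectory ch T δ μ X ε τ) τ k x (t + 1)).card := by
        intro x hx
        by_contra hlt
        have : x ∈ stillActive ch T δ (fun s => μ (X s) + ε s) τ t :=
          (mem_stillActive ch T δ _ τ).2 ⟨hx, not_le.1 hlt⟩
        simp [hact] at this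
      have hball : ∀ x, ∀ b ∈ Metric.closedBall x (radius k),
          ∀ b' ∈ Metric.closedBall x (radius k),
          μ b' ∈ Set.Icc (μ b - 2 * radius k) (μ b + 2 * radius k) := by
        intro x b hb b' hb'
        have h1 := hL.dist_le_mul b' b
        rw [NNReal.coe_one, one_mul, Real.dist_eq] at h1
        have h2 := dist_triangle_right b' b x
        have h3 := abs_le.1 h1
        rw [Metric.mem_closedBall] at hb hb'
        constructor <;> linarith
      obtain ⟨x₀, hx₀, hax₀⟩ := (isCover_toNNReal_iff hr.le).1 (ch.isCover_cover S _ hr) a haS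
      rw [← hcen, Finset.mem_coe] at hx₀
      have hopt : μ a - 3 * radius k < empMean L t k x₀ := by
        have := (empMean_mem_Ioo harm hnoise hthr ht (hcount x₀ hx₀) (hball x₀ a hax₀)).1
        linarith
      have hub : ∀ x ∈ F, empMean L t k x < μ a + radius k := fun x hx =>
        (empMean_mem_Ioo harm hnoise hthr ht (hcount x hx) (b := 0)
          fun b _ => ⟨(hμ b).1, (ha b).2⟩).2
      have hphase : (trajectory ch T δ μ X ε τ (t + 1)).phase = k + 1 := by
        rw [trajectory, hnext]; rfl
      rw [hphase, radius_succ]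
      refine ⟨⋃ x ∈ survivors F L t k, Metric.closedBall x (radius k), ?_, ?_, ?_⟩
      · refine Set.mem_iUnion₂.2 ⟨x₀, ?_, hax₀⟩
        refine Finset.mem_filter.2 ⟨hx₀, fun x hx => ?_⟩
        linarith [hub x hx]
      · intro b hb
        obtain ⟨x, hx, hbx⟩ := Set.mem_iUnion₂.1 hb
        obtain ⟨hxF, hsurv⟩ := Finset.mem_filter.1 hx
        have h1 := hsurv x₀ hx₀
        have h2 := (empMean_mem_Ioo harm hnoise hthr ht (hcount x hxF) (hball x b hbx)).2
        rw [(ha b).1]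
        linarith
      · rw [trajectory, hnext]; rfl

theorem gap_le_of_noiseGood (hL : LipschitzWith 1 μ) (hμ : ∀ x, μ x ∈ Set.Icc (0 : ℝ) 1)
    {a : A} (ha : ∀ x, gap μ x = μ a - μ x ∧ μ x ≤ μ a)
    (harm : ArmsInBalls (trajectory ch T δ μ X ε τ) X T)
    (hnoise : NoiseGood (trajectory ch T δ μ X ε τ) ε τ T δ) (hthr : ∀ k, 1 < threshold T δ k)
    {t : ℕ} (ht : t < T) :
    gap μ (X t) ≤ 22 * radius (trajectory ch T δ μ X ε τ t).phase := by
  obtain ⟨S, -, hS, hcen⟩ := exists_centers_eq_cover hL hμ ha harm hnoise hthr t ht.le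
  obtain ⟨z, hz, hX⟩ := harm t ht
  obtain ⟨j, hj⟩ := exists_roundRobin ch T δ (fun s => μ (X s) + ε s) τ
    (fun k => one_pos.trans (hthr k)) t fun s hs => harm.queue_ne_nil T (by omega)
  have hzc := hj.mem_centers z (List.mem_of_mem_head? hz)
  change z ∈ (trajectory ch T δ μ X ε τ t).centers at hzc
  rw [hcen] at hzc
  obtain ⟨b, hb, hbz⟩ := ch.exists_mem_dist_le (radius_pos _) hzc
  have h1 := gap_le_gap_add_dist hL b (X t)
  have h2 := hS b hb
  have h3 := dist_triangle_right b (X t) z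
  rw [Metric.mem_closedBall] at hX
  linarith

end Elimination

/-! ### The regret bound on the good event -/

section Regret

/-- The exponent of the deviation bounds, `2 exp (-ℓ) = δ / T ^ 2`. -/
noncomputable def logTerm (T : ℕ) (δ : ℝ) : ℝ := 2 * Real.log T + Real.log (2 / δ)

theorem threshold_eq (T : ℕ) (δ : ℝ) (k : ℕ) :
    threshold T δ k = 2 * logTerm T δ / radius k ^ 2 := by
  rw [threshold, logTerm]; ring

theorem one_le_logTerm {T : ℕ} {δ : ℝ} (hT : 2 ≤ T) (hδ : 0 < δ) (hδ1 : δ < 1) :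
    1 ≤ logTerm T δ := by
  have h2 : (2 : ℝ) ≤ T := by exact_mod_cast hT
  have h1 : Real.log 2 ≤ Real.log T := Real.log_le_log (by norm_num) h2
  have h3 : Real.log 2 ≤ Real.log (2 / δ) :=
    Real.log_le_log (by norm_num) ((le_div_iff₀ hδ).2 (by linarith))
  have := Real.log_two_gt_d9
  rw [logTerm]
  linarith

theorem logTerm_le {T : ℕ} {δ : ℝ} (hT : 2 ≤ T) (hδ : 0 < δ) (hδ1 : δ < 1) :
    logTerm T δ ≤ 3 * Real.log (T / δ) := by
  have h2 : (2 : ℝ) ≤ T := by exact_mod_cast hT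
  have h1 : Real.log T ≤ Real.log (T / δ) :=
    Real.log_le_log (by linarith) ((le_div_iff₀ hδ).2 (by nlinarith))
  have h3 : Real.log (2 / δ) ≤ Real.log (T / δ) :=
    Real.log_le_log (by positivity) (by gcongr)
  rw [logTerm]
  linarith

theorem one_lt_threshold {T : ℕ} {δ : ℝ} (hT : 2 ≤ T) (hδ : 0 < δ) (hδ1 : δ < 1) (k : ℕ) :
    1 < threshold T δ k := by
  have h := one_le_logTerm hT hδ hδ1
  have hr := radius_pos k
  have hr1 : radius k ^ 2 ≤ 1 := pow_le_one₀ hr.le (radius_le_one k)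
  rw [threshold_eq, lt_div_iff₀ (by positivity)]
  linarith

theorem radius_rpow_neg (k : ℕ) (e : ℝ) : radius k ^ (-e) = ((2 : ℝ) ^ e) ^ k := by
  rw [radius, ← Real.rpow_natCast, ← Real.rpow_mul (by norm_num), ← Real.rpow_natCast,
    ← Real.rpow_mul (by norm_num), one_div, Real.inv_rpow (by norm_num),
    ← Real.rpow_neg (by norm_num)]
  congr 1
  ring

theorem sum_radius_rpow_neg_le {e : ℝ} (he : 1 ≤ e) (M : ℕ) :
    ∑ k ∈ Finset.Icc 1 M, radius k ^ (-e) ≤ 2 * radius M ^ (-e) := by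
  have hb : (2 : ℝ) ≤ 2 ^ e := by
    simpa using Real.rpow_le_rpow_of_exponent_le (by norm_num : (1 : ℝ) ≤ 2) he
  simp_rw [radius_rpow_neg]
  induction M with
  | zero => simp
  | succ M ih =>
    rw [Finset.sum_Icc_succ_top (by omega), pow_succ]
    have : (0 : ℝ) < (2 ^ e) ^ M := by positivity
    nlinarith

theorem sum_radius_le (M : ℕ) : ∑ k ∈ Finset.Icc 1 M, radius k ≤ 1 := by
  have : ∑ k ∈ Finset.Icc 1 M, radius k = 1 - radius M := by
    induction M with
    | zero => simp [radius]
    | succ M ih =>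
      rw [Finset.sum_Icc_succ_top (by omega), ih, radius_succ]
      ring
  have := radius_pos M
  linarith

/-- The phase at which the two parts of the regret bound balance: its radius is within a factor
two of `ρ = (G / T) ^ (1 / (d + 2))`. It is rounded so that `r_M ≥ ρ`, since a constant factor in
the radius would enter with the unbounded exponent `d + 1`. -/
theorem exists_balancing_phase {T G d : ℝ} (hT : 0 < T) (hG : 0 < G) (hGT : G < T) (hd : 0 ≤ d) :
    ∃ M : ℕ, G * radius M ^ (-(d + 1)) ≤ T ^ ((d + 1) / (d + 2)) * G ^ (1 / (d + 2)) ∧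
      radius M * T ≤ 2 * (T ^ ((d + 1) / (d + 2)) * G ^ (1 / (d + 2))) := by
  set ρ : ℝ := (G / T) ^ (1 / (d + 2)) with hρdef
  have hρ : 0 < ρ := by positivity
  have hρ1 : ρ ≤ 1 := Real.rpow_le_one (by positivity) ((div_le_one hT).2 hGT.le) (by positivity)
  have hW : T ^ ((d + 1) / (d + 2)) * G ^ (1 / (d + 2)) = T * ρ := by
    rw [hρdef, Real.div_rpow hG.le hT.le, mul_div_assoc', mul_comm T, mul_div_assoc,
      mul_comm (T ^ _)]
    congr 1
    rw [eq_div_iff (by positivity), ← Real.rpow_add hT,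
      show (d + 1) / (d + 2) + 1 / (d + 2) = 1 by field_simp; ring, Real.rpow_one]
  have hG' : G * ρ ^ (-(d + 1)) = T * ρ := by
    have h1 : ρ ^ (d + 2) = G / T := by
      rw [hρdef, ← Real.rpow_mul (by positivity), one_div, inv_mul_cancel₀ (by positivity),
        Real.rpow_one]
    have h2 : G = T * ρ ^ (d + 2) := by rw [h1]; field_simp
    conv_lhs => rw [h2]
    rw [mul_assoc, ← Real.rpow_add hρ, show d + 2 + -(d + 1) = 1 by ring, Real.rpow_one]
  obtain ⟨M, hM1, hM2⟩ := exists_nat_pow_near (one_le_one_div hρ hρ1) (one_lt_two (α := ℝ))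
  have hr : radius M = 1 / 2 ^ M := by simp [radius]
  have hρr : ρ ≤ radius M := by
    rw [hr, le_div_iff₀ (by positivity)]
    rwa [le_div_iff₀ hρ, mul_comm] at hM1
  have hrρ : radius M ≤ 2 * ρ := by
    rw [hr, div_le_iff₀ (by positivity)]
    rw [div_lt_iff₀ hρ, pow_succ] at hM2
    linarith
  refine ⟨M, ?_, ?_⟩
  · rw [hW, ← hG']
    have := Real.rpow_le_rpow_of_nonpos hρ hρr (by linarith : -(d + 1) ≤ 0)
    gcongr
  · rw [hW]
    nlinarith

variable {A : Type*} {T : ℕ} {δ : ℝ} {μ : A → ℝ} {X : ℕ → A} {ε : ℕ → ℝ} {τ : ℕ → ℕ∞}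

theorem sum_gap_le_sum_phase (st : ℕ → State A) (hst : ∀ t, 1 ≤ (st t).phase)
    (hgap : ∀ t < T, gap μ (X t) ≤ 22 * radius (st t).phase) (M : ℕ) :
    ∑ t ∈ Finset.range T, gap μ (X t) ≤
      22 * (∑ k ∈ Finset.Icc 1 M,
        radius k * ((Finset.range T).filter fun t => (st t).phase = k).card + radius M * T) := by
  have hpt : ∀ t ∈ Finset.range T, gap μ (X t) ≤
      ∑ k ∈ Finset.Icc 1 M, (if (st t).phase = k then 22 * radius k else 0) + 22 * radius M := by
    intro t ht
    refine (hgap t (Finset.mem_range.1 ht)).trans ?_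
    have hM := radius_pos M
    rw [Finset.sum_ite_eq]
    split_ifs with h
    · linarith
    · have hlt : M ≤ (st t).phase := by
        have := hst t
        rw [Finset.mem_Icc] at h
        omega
      have : radius (st t).phase ≤ radius M :=
        pow_le_pow_of_le_one (by norm_num) (by norm_num) hlt
      linarith
  refine (Finset.sum_le_sum hpt).trans (le_of_eq ?_)
  rw [Finset.sum_add_distrib, Finset.sum_comm, mul_add, Finset.mul_sum]
  congr 1
  · refine Finset.sum_congr rfl fun k _ => ?_
    rw [← Finset.sum_filter, Finset.sum_const, nsmul_eq_mul]
    ring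
  · rw [Finset.sum_const, Finset.card_range, nsmul_eq_mul]
    ring

variable [MetricSpace A] {ch : Choices A}

/-- The contribution of phase `k` to the regret. -/
theorem radius_mul_card_phase_le [CompactSpace A] [Nonempty A] {N : ℕ} (hN : IsDoubling A N)
    (hdiam : ∀ x y : A, dist x y ≤ 1) (hμ : ∀ x, μ x ∈ Set.Icc (0 : ℝ) 1)
    (hL : LipschitzWith 1 μ) {c d : ℝ} (hz : HasZoomingBound μ c d) (hT : 2 ≤ T) (hδ : 0 < δ)
    (hδ1 : δ < 1) (harm : ArmsInBalls (trajectory ch T δ μ X ε τ) X T)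
    (hnoise : NoiseGood (trajectory ch T δ μ X ε τ) ε τ T δ) {p : ℝ} (hp : 0 < p) (hp1 : p ≤ 1)
    {q : ℕ} (hdelay : DelayGood (trajectory ch T δ μ X ε τ) τ T q p (logTerm T δ)) (k : ℕ) :
    radius k * ((Finset.range T).filter fun t => (trajectory ch T δ μ X ε τ t).phase = k).card ≤
      8 * N ^ 5 * (c * logTerm T δ) / p * radius k ^ (-(d + 1)) + radius k * q := by
  have hr := radius_pos k
  have hr1 := radius_le_one k
  have hℓ := one_le_logTerm hT hδ hδ1
  have hthr := one_lt_threshold hT hδ hδ1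
  have hc := hz.one_le hμ
  obtain ⟨a, ha⟩ := exists_gap_eq hL
  rcases ((Finset.range T).filter
    fun t => (trajectory ch T δ μ X ε τ t).phase = k).eq_empty_or_nonempty with h | h
  · rw [h]
    simp only [Finset.card_empty, Nat.cast_zero, mul_zero]
    positivity
  set t := ((Finset.range T).filter
    fun t => (trajectory ch T δ μ X ε τ t).phase = k).max' h with ht
  obtain ⟨htT, hph⟩ := Finset.mem_filter.1 (Finset.max'_mem _ h)
  rw [← ht] at htT hph
  rw [Finset.mem_range] at htT
  obtain ⟨S, -, hS, hcen⟩ := exists_centers_eq_cover hL hμ ha harm hnoise hthr t htT.le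
  have h1 := card_phase_le_of_delayGood ch T δ (fun s => μ (X s) + ε s) τ hp (by linarith)
    (fun k => one_pos.trans (hthr k)) hdelay htT fun s hs => harm.queue_ne_nil T (by omega)
  have h2 : ((Finset.range T).filter fun t => (trajectory ch T δ μ X ε τ t).phase = k).card ≤
      ((Finset.range (t + 1)).filter fun s => (trajectory ch T δ μ X ε τ s).phase =
        (trajectory ch T δ μ X ε τ t).phase).card := by
    refine Finset.card_le_card fun s hs => Finset.mem_filter.2 ⟨?_, ?_⟩
    · have := Finset.le_max' _ s hs
      rw [Finset.mem_range]
      omega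
    · rw [hph]
      exact (Finset.mem_filter.1 hs).2
  have h3 : ((trajectory ch T δ μ X ε τ t).centers.card : ℝ) ≤ N ^ 5 * (c * radius k ^ (-d)) := by
    rw [hcen, hph]
    rw [hph] at hS
    exact ch.card_cover_le hN hdiam hμ hz k hS
  have h4 : (1 : ℝ) ≤ N ^ 5 * (c * radius k ^ (-d)) := by
    have e1 : (1 : ℝ) ≤ N ^ 5 := one_le_pow₀ (by exact_mod_cast hN.one_le)
    have e2 := Real.one_le_rpow_of_pos_of_le_one_of_nonpos hr hr1 (neg_nonpos.2 hz.2.1)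
    exact one_le_mul_of_one_le_of_one_le e1 (one_le_mul_of_one_le_of_one_le hc e2)
  set B : ℝ := N ^ 5 * (c * radius k ^ (-d)) with hB
  set V : ℝ := logTerm T δ / (radius k ^ 2 * p) with hV
  have hrp : radius k ^ 2 * p ≤ 1 := mul_le_one₀ (pow_le_one₀ hr.le hr1) hp.le hp1
  have hV1 : 1 ≤ V := by
    rw [hV, le_div_iff₀ (by positivity)]
    linarith
  have h5 : 2 * (threshold T δ k + logTerm T δ) / p + 1 ≤ 7 * V := by
    have e1 : threshold T δ k / p = 2 * V := by
      rw [threshold_eq, hV]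
      field_simp
    have e2 : logTerm T δ / p ≤ V := by
      rw [hV]
      gcongr
      exact mul_le_of_le_one_left hp.le (pow_le_one₀ hr.le hr1)
    have e3 : 2 * (threshold T δ k + logTerm T δ) / p =
        2 * (threshold T δ k / p) + 2 * (logTerm T δ / p) := by ring
    linarith
  have h6 : (((Finset.range T).filter
      fun t => (trajectory ch T δ μ X ε τ t).phase = k).card : ℝ) ≤ 8 * (B * V) + q := by
    refine (Nat.cast_le.2 h2).trans (h1.trans ?_)
    change ((trajectory ch T δ μ X ε τ t).centers.card : ℝ) *
      (2 * (threshold T δ (trajectory ch T δ μ X ε τ t).phase + logTerm T δ) / p + 1) + q + 1 ≤ _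
    rw [hph]
    have e1 : ((trajectory ch T δ μ X ε τ t).centers.card : ℝ) *
        (2 * (threshold T δ k + logTerm T δ) / p + 1) ≤ B * (7 * V) :=
      mul_le_mul h3 h5 (by have := hthr k; positivity) (by linarith)
    have e2 : 1 ≤ B * V := one_le_mul_of_one_le_of_one_le h4 hV1
    linarith
  have h7 : radius k * (B * V) =
      N ^ 5 * (c * logTerm T δ) / p * radius k ^ (-(d + 1)) := by
    have e : radius k ^ (-(d + 1)) = radius k ^ (-d) / radius k := by
      rw [show -(d + 1) = -d - 1 by ring, Real.rpow_sub_one hr.ne']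
    rw [hB, hV, e]
    field_simp
  calc _ ≤ radius k * (8 * (B * V) + q) := by gcongr
    _ = 8 * (radius k * (B * V)) + radius k * q := by ring
    _ = _ := by rw [h7]; ring

theorem sum_gap_le_of_good [CompactSpace A] [Nonempty A] {N : ℕ} (hN : IsDoubling A N)
    (hdiam : ∀ x y : A, dist x y ≤ 1) (hμ : ∀ x, μ x ∈ Set.Icc (0 : ℝ) 1)
    (hL : LipschitzWith 1 μ) {c d : ℝ} (hz : HasZoomingBound μ c d) (hT : 2 ≤ T) (hδ : 0 < δ)
    (hδ1 : δ < 1) (harm : ArmsInBalls (trajectory ch T δ μ X ε τ) X T)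
    (hnoise : NoiseGood (trajectory ch T δ μ X ε τ) ε τ T δ) {p : ℝ} (hp : 0 < p) (hp1 : p ≤ 1)
    {q : ℕ} (hdelay : DelayGood (trajectory ch T δ μ X ε τ) τ T q p (logTerm T δ)) :
    ∑ t ∈ Finset.range T, gap μ (X t) ≤ 1100 * N ^ 5 *
      (1 / p * (T : ℝ) ^ ((d + 1) / (d + 2)) * (c * Real.log (T / δ)) ^ (1 / (d + 2)) + q) := by
  have hN1 : (1 : ℝ) ≤ N ^ 5 := one_le_pow₀ (by exact_mod_cast hN.one_le)
  have hc := hz.one_le hμ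
  have hd : 0 ≤ d := hz.2.1
  have hT0 : (0 : ℝ) < T := by exact_mod_cast (by omega : 0 < T)
  have hℓ := one_le_logTerm hT hδ hδ1
  have hℓ3 := logTerm_le hT hδ hδ1
  obtain ⟨a, ha⟩ := exists_gap_eq hL
  set G : ℝ := c * Real.log (T / δ) with hGdef
  have hG : 0 < G := mul_pos (by linarith) (by linarith)
  have hGℓ : c * logTerm T δ ≤ 3 * G := by
    rw [hGdef]
    nlinarith
  set W : ℝ := (T : ℝ) ^ ((d + 1) / (d + 2)) * G ^ (1 / (d + 2)) with hW
  have hWpos : 0 < W := by positivity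
  have hWp : W ≤ 1 / p * W := le_mul_of_one_le_left hWpos.le (one_le_one_div hp hp1)
  have hq0 : (0 : ℝ) ≤ q := Nat.cast_nonneg q
  rw [mul_assoc (1 / p), ← hW]
  rcases le_or_gt (T : ℝ) G with hTG | hGT
  · -- the trivial bound of the regret by the number of rounds
    have h1 : ∑ t ∈ Finset.range T, gap μ (X t) ≤ T := by
      have := Finset.sum_le_card_nsmul (Finset.range T) (fun t => gap μ (X t)) 1 fun t _ => by
        rw [(ha (X t)).1]
        linarith [(hμ a).2, (hμ (X t)).1]
      simpa using this
    have h2 : (T : ℝ) ≤ W := by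
      calc (T : ℝ) = (T : ℝ) ^ ((d + 1) / (d + 2)) * (T : ℝ) ^ (1 / (d + 2)) := by
            rw [← Real.rpow_add hT0,
              show (d + 1) / (d + 2) + 1 / (d + 2) = 1 by field_simp; ring, Real.rpow_one]
        _ ≤ W := by rw [hW]; gcongr
    have h3 : 1 / p * W + q ≤ 1100 * N ^ 5 * (1 / p * W + q) :=
      le_mul_of_one_le_left (by linarith) (by linarith)
    linarith
  · obtain ⟨M, hM1, hM2⟩ := exists_balancing_phase hT0 hG hGT hd
    rw [← hW] at hM1 hM2
    have hthr := one_lt_threshold hT hδ hδ1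
    have h1 := sum_gap_le_sum_phase (trajectory ch T δ μ X ε τ) (one_le_phase ch T δ _ τ)
      (fun t ht => gap_le_of_noiseGood hL hμ ha harm hnoise hthr ht) M
    have h2 : ∑ k ∈ Finset.Icc 1 M, radius k *
        ((Finset.range T).filter fun t => (trajectory ch T δ μ X ε τ t).phase = k).card ≤
        8 * N ^ 5 * (c * logTerm T δ) / p * (2 * radius M ^ (-(d + 1))) + q := by
      refine (Finset.sum_le_sum fun k _ => radius_mul_card_phase_le hN hdiam hμ hL hz hT hδ hδ1
        harm hnoise hp hp1 hdelay k).trans ?_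
      rw [Finset.sum_add_distrib, ← Finset.mul_sum, ← Finset.sum_mul]
      have e1 := sum_radius_rpow_neg_le (by linarith : 1 ≤ d + 1) M
      have e2 := sum_radius_le M
      have e3 : (∑ k ∈ Finset.Icc 1 M, radius k) * (q : ℝ) ≤ q := mul_le_of_le_one_left hq0 e2
      gcongr
    have h3 : 8 * N ^ 5 * (c * logTerm T δ) / p * (2 * radius M ^ (-(d + 1))) ≤
        48 * N ^ 5 * (1 / p * W) := by
      have hrM : 0 < radius M ^ (-(d + 1)) := Real.rpow_pos_of_pos (radius_pos M) _
      calc _ ≤ 8 * N ^ 5 * (3 * G) / p * (2 * radius M ^ (-(d + 1))) := by gcongr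
        _ = 48 * N ^ 5 * (1 / p * (G * radius M ^ (-(d + 1)))) := by ring
        _ ≤ _ := by gcongr
    have h4 : (1 / p * W + q) ≤ N ^ 5 * (1 / p * W + q) :=
      le_mul_of_one_le_left (by linarith) hN1
    have h5 : (q : ℝ) ≤ N ^ 5 * q := le_mul_of_one_le_left hq0 hN1
    have h6 : 1 / p * W ≤ N ^ 5 * (1 / p * W) := le_mul_of_one_le_left (by linarith) hN1
    nlinarith

end Regret

/-! ### The good event has probability at least `1 - δ` -/

section Info

variable {Ω E : Type*} [MeasurableSpace E] {Z : ℕ → Ω → E}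

theorem measurable_info {I : Set ℕ} {s : ℕ} (hs : s ∈ I) : Measurable[info Z I] (Z s) := by
  rw [measurable_iff_comap_le]
  exact le_iSup₂_of_le s hs le_rfl

theorem info_le {mΩ : MeasurableSpace Ω} (hZ : ∀ s, Measurable (Z s)) (I : Set ℕ) :
    info Z I ≤ mΩ :=
  iSup₂_le fun s _ => (hZ s).comap_le

end Info

section GoodEvent

variable {A : Type*} [MetricSpace A] {Ω : Type*} {ch : Choices A} {T : ℕ}
  {δ : ℝ} {μ : A → ℝ} {X : ℕ → Ω → A} {ε : ℕ → Ω → ℝ} {τ : ℕ → Ω → ℕ∞}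

/-- The trajectory at the outcome `ω`. -/
noncomputable abbrev runAt (ch : Choices A) (T : ℕ) (δ : ℝ) (μ : A → ℝ) (X : ℕ → Ω → A)
    (ε : ℕ → Ω → ℝ) (τ : ℕ → Ω → ℕ∞) (ω : Ω) : ℕ → State A :=
  trajectory ch T δ μ (fun s => X s ω) (fun s => ε s ω) (fun s => τ s ω)

section Measurability

variable [MeasurableSpace A] [BorelSpace A] {m : MeasurableSpace Ω} {n : ℕ}

theorem stateMeasurableOn_runAt (hL : LipschitzWith 1 μ) (hX : ∀ s < n, Measurable[m] (X s))
    (hε : ∀ s < n, Measurable[m] (ε s)) (hτ : ∀ s < n, Measurable[m] (τ s)) :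
    StateMeasurableOn m (fun ω => runAt ch T δ μ X ε τ ω n) Set.univ :=
  stateMeasurableOn_state ch T δ (y := fun s ω => μ (X s ω) + ε s ω) n
    (fun s hs => (hL.continuous.measurable.comp (hX s hs)).add (hε s hs)) hτ

theorem measurableSet_samePlay (hL : LipschitzWith 1 μ) (hX : ∀ s < n, Measurable[m] (X s))
    (hε : ∀ s < n, Measurable[m] (ε s)) (hτ : ∀ s < n, Measurable[m] (τ s)) (s₀ : ℕ) :
    MeasurableSet[m] {ω | s₀ ≤ n ∧ SamePlay (runAt ch T δ μ X ε τ ω) s₀ n} := by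
  by_cases h : s₀ ≤ n
  · simp only [h, true_and]
    exact measurableSet_of_stateMeasurableOn
      (stateMeasurableOn_runAt hL (fun s hs => hX s (by omega)) (fun s hs => hε s (by omega))
        fun s hs => hτ s (by omega))
      (stateMeasurableOn_runAt (n := n) hL hX hε hτ)
      fun k₁ q₁ k₂ q₂ => k₂ = k₁ ∧ q₂.head? = q₁.head?
  · simp [h]

theorem measurable_phase (hL : LipschitzWith 1 μ) (hX : ∀ s < n, Measurable[m] (X s))
    (hε : ∀ s < n, Measurable[m] (ε s)) (hτ : ∀ s < n, Measurable[m] (τ s)) :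
    Measurable[m] fun ω => (runAt ch T δ μ X ε τ ω n).phase := by
  refine measurable_to_countable' fun k => ?_
  have h := stateMeasurableOn_runAt (ch := ch) (T := T) (δ := δ) hL hX hε hτ
  exact measurableSet_of_stateMeasurableOn h h fun k₁ _ _ _ => k₁ = k

end Measurability

open scoped Classical in
/-- The scale `σ r_k` with which the noise of round `s` enters the deviation bound for the ball
first played in round `s₀`, if round `s` plays this ball with a reward observed by the end of
round `u`; otherwise `0`. -/
noncomputable def noiseScale (ch : Choices A) (T : ℕ) (δ : ℝ) (μ : A → ℝ) (X : ℕ → Ω → A)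
    (ε : ℕ → Ω → ℝ) (τ : ℕ → Ω → ℕ∞) (σ : ℝ) (s₀ u s : ℕ) (ω : Ω) : ℝ :=
  if (s₀ ≤ s ∧ SamePlay (runAt ch T δ μ X ε τ ω) s₀ s) ∧ (s : ℕ∞) + τ s ω < (u + 1 : ℕ) then
    σ * radius (runAt ch T δ μ X ε τ ω s₀).phase else 0

open scoped Classical in
/-- The increment in round `s` of the exponent of the supermartingale which counts the plays with
delay at most `q` of the ball first played in round `s₀`. -/
noncomputable def delayIncrement (ch : Choices A) (T : ℕ) (δ : ℝ) (μ : A → ℝ) (X : ℕ → Ω → A)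
    (ε : ℕ → Ω → ℝ) (τ : ℕ → Ω → ℕ∞) (p : ℝ) (q s₀ s : ℕ) (ω : Ω) : ℝ :=
  if s₀ ≤ s ∧ SamePlay (runAt ch T δ μ X ε τ ω) s₀ s then
    p / 2 - (if τ s ω ≤ q then 1 else 0) else 0

theorem exp_neg_logTerm (hT : 2 ≤ T) (hδ : 0 < δ) :
    Real.exp (-logTerm T δ) = δ / (2 * (T : ℝ) ^ 2) := by
  have hT0 : (0 : ℝ) < T := by exact_mod_cast (by omega : 0 < T)
  have : logTerm T δ = Real.log ((T : ℝ) ^ 2 * (2 / δ)) := by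
    rw [logTerm, Real.log_mul (by positivity) (by positivity), Real.log_pow]
    norm_num
  rw [Real.exp_neg, this, Real.exp_log (by positivity)]
  field_simp

theorem logTerm_le_of_not_noiseGood {ω : Ω}
    (h : ¬ NoiseGood (runAt ch T δ μ X ε τ ω) (fun s => ε s ω) (fun s => τ s ω) T δ) :
    ∃ u < T, ∃ s₀ < u, ∃ σ : ℝ, (σ = 1 ∨ σ = -1) ∧ logTerm T δ ≤
      ∑ s ∈ Finset.range (u + 1), (noiseScale ch T δ μ X ε τ σ s₀ u s ω * ε s ω -
        noiseScale ch T δ μ X ε τ σ s₀ u s ω ^ 2 / 2) := by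
  classical
  simp only [NoiseGood, not_forall, not_lt] at h
  obtain ⟨u, hu, s₀, hs₀, hthr, hdev⟩ := h
  set r := radius (runAt ch T δ μ X ε τ ω s₀).phase with hrdef
  have hr : 0 < r := radius_pos _
  set O := (Finset.range (u + 1)).filter fun s : ℕ =>
    (s₀ ≤ s ∧ SamePlay (runAt ch T δ μ X ε τ ω) s₀ s) ∧ (s : ℕ∞) + τ s ω < (u + 1 : ℕ) with hO
  have hsum : ∀ σ : ℝ, σ ^ 2 = 1 → ∑ s ∈ Finset.range (u + 1),
      (noiseScale ch T δ μ X ε τ σ s₀ u s ω * ε s ω -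
        noiseScale ch T δ μ X ε τ σ s₀ u s ω ^ 2 / 2) =
      r * (σ * ∑ s ∈ O, ε s ω) - O.card * (r ^ 2 / 2) := by
    intro σ hσ
    have hpt : ∀ s ∈ Finset.range (u + 1), noiseScale ch T δ μ X ε τ σ s₀ u s ω * ε s ω -
        noiseScale ch T δ μ X ε τ σ s₀ u s ω ^ 2 / 2 =
        if (s₀ ≤ s ∧ SamePlay (runAt ch T δ μ X ε τ ω) s₀ s) ∧ (s : ℕ∞) + τ s ω < (u + 1 : ℕ) then
          σ * r * ε s ω - r ^ 2 / 2 else 0 := by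
      intro s _
      rw [noiseScale]
      split_ifs
      · rw [mul_pow, hσ, one_mul]
      · simp
    rw [Finset.sum_congr rfl hpt, ← Finset.sum_filter, ← hO, Finset.sum_sub_distrib,
      ← Finset.mul_sum, Finset.sum_const, nsmul_eq_mul]
    ring
  rw [threshold_eq, ← hrdef, div_le_iff₀ (by positivity)] at hthr
  refine ⟨u, hu, s₀, hs₀, ?_⟩
  rcases le_abs.1 hdev with h | h
  · refine ⟨1, Or.inl rfl, ?_⟩
    rw [hsum 1 (by norm_num)]
    nlinarith
  · refine ⟨-1, Or.inr rfl, ?_⟩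
    rw [hsum (-1) (by norm_num)]
    nlinarith

theorem logTerm_le_of_not_delayGood {p : ℝ} {q : ℕ} {ω : Ω}
    (h : ¬ DelayGood (runAt ch T δ μ X ε τ ω) (fun s => τ s ω) T q p (logTerm T δ)) :
    ∃ u < T, ∃ s₀ < T, logTerm T δ ≤
      ∑ s ∈ Finset.range (u + 1), delayIncrement ch T δ μ X ε τ p q s₀ s ω := by
  classical
  simp only [DelayGood, not_forall, not_lt] at h
  obtain ⟨s₀, u, hs₀, hu, h⟩ := h
  refine ⟨u, hu, s₀, by omega, h.trans (le_of_eq ?_)⟩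
  have hpt : ∀ s ∈ Finset.range (u + 1), delayIncrement ch T δ μ X ε τ p q s₀ s ω =
      (if s₀ ≤ s ∧ SamePlay (runAt ch T δ μ X ε τ ω) s₀ s then p / 2 else 0) -
      if (s₀ ≤ s ∧ SamePlay (runAt ch T δ μ X ε τ ω) s₀ s) ∧ τ s ω ≤ q then 1 else 0 := by
    intro s _
    rw [delayIncrement]
    split_ifs <;> simp_all
  rw [Finset.sum_congr rfl hpt, Finset.sum_sub_distrib, ← Finset.sum_filter, ← Finset.sum_filter,
    Finset.sum_const, Finset.sum_const, nsmul_eq_mul, nsmul_eq_mul]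
  ring

variable [MeasurableSpace A] {ν : Measure ℕ∞} {mΩ : MeasurableSpace Ω} {P : Measure Ω}

theorem IsRun.armsInBalls (h : IsRun ch T δ μ ν P X ε τ) (ω : Ω) :
    ArmsInBalls (runAt ch T δ μ X ε τ ω) (fun s => X s ω) T :=
  fun t ht => h.arm_mem t ht ω

variable [BorelSpace A] [IsProbabilityMeasure P]

/-- The deviation bound for the noise. Given the pulled arms and the past noise, and all delays,
the scale of the current noise is known, so the exponents form a supermartingale. -/
theorem IsRun.measure_noise_le (h : IsRun ch T δ μ ν P X ε τ) (hL : LipschitzWith 1 μ)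
    {σ : ℝ} {u s₀ : ℕ} (hu : u < T) (a : ℝ) :
    P {ω | a ≤ ∑ s ∈ Finset.range (u + 1), (noiseScale ch T δ μ X ε τ σ s₀ u s ω * ε s ω -
        noiseScale ch T δ μ X ε τ σ s₀ u s ω ^ 2 / 2)} ≤ ENNReal.ofReal (Real.exp (-a)) := by
  classical
  set F : ℕ → MeasurableSpace Ω :=
    fun s => info X (Set.Iic s) ⊔ info ε (Set.Iio s) ⊔ info τ (Set.Iio T) with hF
  have hFX : ∀ s j, j ≤ s → Measurable[F s] (X j) := fun s j hj =>
    (measurable_info (Set.mem_Iic.2 hj)).mono (le_sup_left.trans le_sup_left) le_rfl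
  have hFε : ∀ s j, j < s → Measurable[F s] (ε j) := fun s j hj =>
    (measurable_info (Set.mem_Iio.2 hj)).mono (le_sup_right.trans le_sup_left) le_rfl
  have hFτ : ∀ s j, j < T → Measurable[F s] (τ j) := fun s j hj =>
    (measurable_info (Set.mem_Iio.2 hj)).mono le_sup_right le_rfl
  have hFle : ∀ s, F s ≤ mΩ := fun s => sup_le (sup_le (info_le h.measurable_arm _)
    (info_le h.measurable_noise _)) (info_le h.measurable_delay _)
  have hscale : ∀ s < u + 1, ∀ j ≤ s,
      Measurable[F s] (noiseScale ch T δ μ X ε τ σ s₀ u j) := by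
    intro s hs j hj
    have hset := measurableSet_samePlay (m := F s) (n := j) (ch := ch) (T := T) (δ := δ) (X := X)
      (ε := ε) (τ := τ) hL (fun i hi => hFX s i (by omega)) (fun i hi => hFε s i (by omega))
      (fun i hi => hFτ s i (by omega)) s₀
    have hobs : MeasurableSet[F s] {ω | (j : ℕ∞) + τ j ω < (u + 1 : ℕ)} :=
      hFτ s j (by omega) (MeasurableSet.of_discrete (s := {n | (j : ℕ∞) + n < (u + 1 : ℕ)}))
    by_cases hj₀ : s₀ ≤ j
    · refine Measurable.ite (hset.inter hobs) (measurable_const.mul ?_) measurable_const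
      exact (measurable_of_countable radius).comp (measurable_phase hL
        (fun i hi => hFX s i (by omega)) (fun i hi => hFε s i (by omega))
        fun i hi => hFτ s i (by omega))
    · have : noiseScale ch T δ μ X ε τ σ s₀ u j = fun _ => 0 := by
        funext ω
        simp [noiseScale, hj₀]
      rw [this]
      exact measurable_const
  refine measure_le_sum_le_exp_neg F _ (u + 1) (fun s _ => hFle s) (fun s hs => ?_)
    (fun s hs j hj => ?_) a
  · set l := noiseScale ch T δ μ X ε τ σ s₀ u s with hl
    have hrange : (Set.range l).Countable := by
      refine ((Set.countable_range fun k => σ * radius k).insert 0).mono ?_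
      rintro _ ⟨ω, rfl⟩
      rw [hl, noiseScale]
      split_ifs
      · exact Or.inr ⟨_, rfl⟩
      · exact Or.inl rfl
    have := hrange.to_subtype
    refine CondExpLeOne.select (ι := Set.range l)
      (G := fun i ω => ENNReal.ofReal (Real.exp (i.1 * ε s ω - i.1 ^ 2 / 2)))
      (κ := Set.rangeFactorization l)
      (fun i => (h.noise s (by omega)).condExpLeOne (hFle s) (h.measurable_noise s) i.1)
      (hFle s) fun i => ?_
    have : Set.rangeFactorization l ⁻¹' {i} = l ⁻¹' {i.1} := by
      ext ω
      simp [Subtype.ext_iff, Set.rangeFactorization]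
    rw [this]
    exact hscale s hs s le_rfl (measurableSet_singleton _)
  · have h1 := hscale s hs j hj.le
    exact (h1.mul (hFε s j hj)).sub ((h1.pow_const 2).div_const 2)

/-- The deviation bound for the delays. Which ball is played in a round is determined by the past,
of which the delay of that round is independent. -/
theorem IsRun.measure_delay_le (h : IsRun ch T δ μ ν P X ε τ) (hL : LipschitzWith 1 μ) {p : ℝ}
    {q : ℕ} (hq : ENNReal.ofReal p ≤ ν (Set.Iic (q : ℕ∞))) {u s₀ : ℕ} (hu : u < T) (a : ℝ) :
    P {ω | a ≤ ∑ s ∈ Finset.range (u + 1), delayIncrement ch T δ μ X ε τ p q s₀ s ω} ≤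
      ENNReal.ofReal (Real.exp (-a)) := by
  classical
  set F : ℕ → MeasurableSpace Ω :=
    fun s => info X (Set.Iic s) ⊔ info ε (Set.Iic s) ⊔ info τ (Set.Iio s) with hF
  have hFX : ∀ s j, j ≤ s → Measurable[F s] (X j) := fun s j hj =>
    (measurable_info (Set.mem_Iic.2 hj)).mono (le_sup_left.trans le_sup_left) le_rfl
  have hFε : ∀ s j, j ≤ s → Measurable[F s] (ε j) := fun s j hj =>
    (measurable_info (Set.mem_Iic.2 hj)).mono (le_sup_right.trans le_sup_left) le_rfl
  have hFτ : ∀ s j, j < s → Measurable[F s] (τ j) := fun s j hj =>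
    (measurable_info (Set.mem_Iio.2 hj)).mono le_sup_right le_rfl
  have hFle : ∀ s, F s ≤ mΩ := fun s => sup_le (sup_le (info_le h.measurable_arm _)
    (info_le h.measurable_noise _)) (info_le h.measurable_delay _)
  have hset : ∀ s, ∀ j ≤ s,
      MeasurableSet[F s] {ω | s₀ ≤ j ∧ SamePlay (runAt ch T δ μ X ε τ ω) s₀ j} :=
    fun s j hj => measurableSet_samePlay hL (fun i hi => hFX s i (by omega))
      (fun i hi => hFε s i (by omega)) (fun i hi => hFτ s i (by omega)) s₀
  refine measure_le_sum_le_exp_neg F _ (u + 1) (fun s _ => hFle s) (fun s hs => ?_)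
    (fun s hs j hj => ?_) a
  · have hAinfo : MeasurableSet[info τ {s}] (τ s ⁻¹' Set.Iic (q : ℕ∞)) :=
      measurable_info (Set.mem_singleton s) MeasurableSet.of_discrete
    have hA : MeasurableSet (τ s ⁻¹' Set.Iic (q : ℕ∞)) :=
      h.measurable_delay s MeasurableSet.of_discrete
    have hpA : ENNReal.ofReal p ≤ P (τ s ⁻¹' Set.Iic (q : ℕ∞)) := by
      rwa [← Measure.map_apply (h.measurable_delay s) MeasurableSet.of_discrete,
        h.delay_law s (by omega)]
    have hsel := CondExpLeOne.select (P := P) (m := F s) (ι := Prop)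
      (G := fun i ω => if i then ENNReal.ofReal (Real.exp (p / 2 -
        if ω ∈ τ s ⁻¹' Set.Iic (q : ℕ∞) then (1 : ℝ) else 0)) else 1)
      (κ := fun ω => s₀ ≤ s ∧ SamePlay (runAt ch T δ μ X ε τ ω) s₀ s) ?_ (hFle s) ?_
    · refine (congrArg (CondExpLeOne P (F s)) (funext fun ω => ?_)).mpr hsel
      by_cases hw : s₀ ≤ s ∧ SamePlay (runAt ch T δ μ X ε τ ω) s₀ s
      · rw [delayIncrement, if_pos hw, if_pos hw, if_congr
          (show τ s ω ≤ q ↔ ω ∈ τ s ⁻¹' Set.Iic (q : ℕ∞) from Iff.rfl) rfl rfl]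
      · rw [delayIncrement, if_neg hw, if_neg hw, Real.exp_zero, ENNReal.ofReal_one]
    · intro i
      by_cases hi : i
      · simp only [hi, if_true]
        exact condExpLeOne_exp_sub_indicator (hFle s) hA hpA fun S hS =>
          (Indep_iff _ _ _).1 (h.delay_indep s (by omega)) _ _ hAinfo hS
      · simp only [hi, if_false]
        exact condExpLeOne_one
    · intro i
      by_cases hi : i
      · refine (congrArg (MeasurableSet[F s]) (Set.ext fun ω => ?_)).mpr (hset s s le_rfl)
        rw [Set.mem_preimage, Set.mem_singleton_iff, eq_iff_iff, iff_true_right hi]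
        rfl
      · refine (congrArg (MeasurableSet[F s]) (Set.ext fun ω => ?_)).mpr (hset s s le_rfl).compl
        rw [Set.mem_preimage, Set.mem_singleton_iff, eq_iff_iff, iff_false_right hi]
        rfl
  · have hobs : MeasurableSet[F s] {ω | τ j ω ≤ (q : ℕ∞)} :=
      hFτ s j hj (MeasurableSet.of_discrete (s := Set.Iic (q : ℕ∞)))
    exact Measurable.ite (hset s j hj.le)
      (measurable_const.sub (Measurable.ite hobs measurable_const measurable_const))
      measurable_const

/-- The noise is tame with probability at least `1 - δ / 2`: as a ball needs at least two
observations, only the `T (T - 1) / 2` pairs of rounds `s₀ < u` count, with two deviations each. -/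
theorem IsRun.measure_not_noiseGood_le (h : IsRun ch T δ μ ν P X ε τ) (hL : LipschitzWith 1 μ)
    (hT : 2 ≤ T) (hδ : 0 < δ) :
    P {ω | ¬ NoiseGood (runAt ch T δ μ X ε τ ω) (fun s => ε s ω) (fun s => τ s ω) T δ} ≤
      ENNReal.ofReal (δ / 2) := by
  have hT0 : (0 : ℝ) < T := by exact_mod_cast (by omega : 0 < T)
  set E : ℝ → ℕ → ℕ → Set Ω := fun σ u s₀ => {ω | logTerm T δ ≤
    ∑ s ∈ Finset.range (u + 1), (noiseScale ch T δ μ X ε τ σ s₀ u s ω * ε s ω -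
        noiseScale ch T δ μ X ε τ σ s₀ u s ω ^ 2 / 2)} with hE
  have hle : ∀ σ, ∀ u < T, ∀ s₀, P (E σ u s₀) ≤ ENNReal.ofReal (δ / (2 * (T : ℝ) ^ 2)) := by
    intro σ u hu s₀
    rw [← exp_neg_logTerm hT hδ]
    exact h.measure_noise_le hL hu _
  calc _ ≤ P (⋃ u ∈ Finset.range T, ⋃ s₀ ∈ Finset.range u, (E 1 u s₀ ∪ E (-1) u s₀)) := by
        refine measure_mono fun ω hω => ?_
        obtain ⟨u, hu, s₀, hs₀, σ, hσ, hdev⟩ := logTerm_le_of_not_noiseGood hω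
        refine Set.mem_iUnion₂.2 ⟨u, Finset.mem_range.2 hu,
          Set.mem_iUnion₂.2 ⟨s₀, Finset.mem_range.2 hs₀, ?_⟩⟩
        rcases hσ with rfl | rfl
        · exact Or.inl hdev
        · exact Or.inr hdev
    _ ≤ ∑ u ∈ Finset.range T, ∑ s₀ ∈ Finset.range u,
          (ENNReal.ofReal (δ / (2 * (T : ℝ) ^ 2)) + ENNReal.ofReal (δ / (2 * (T : ℝ) ^ 2))) := by
        refine (measure_biUnion_finset_le _ _).trans (Finset.sum_le_sum fun u hu => ?_)
        refine (measure_biUnion_finset_le _ _).trans (Finset.sum_le_sum fun s₀ _ => ?_)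
        rw [Finset.mem_range] at hu
        exact (measure_union_le _ _).trans (add_le_add (hle _ u hu s₀) (hle _ u hu s₀))
    _ = ENNReal.ofReal (∑ u ∈ Finset.range T, (u : ℝ) * (δ / (T : ℝ) ^ 2)) := by
        rw [ENNReal.ofReal_sum_of_nonneg fun u _ => by positivity]
        refine Finset.sum_congr rfl fun u _ => ?_
        rw [Finset.sum_const, Finset.card_range, ← ENNReal.ofReal_add (by positivity)
          (by positivity), nsmul_eq_mul, ENNReal.ofReal_mul (by positivity), ENNReal.ofReal_natCast]
        congr 2
        field_simp
        norm_num
    _ ≤ ENNReal.ofReal (δ / 2) := by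
        refine ENNReal.ofReal_le_ofReal ?_
        have hsum : (∑ u ∈ Finset.range T, (u : ℝ)) * 2 = T * (T - 1) := by
          have := Finset.sum_range_id_mul_two T
          have h1 : ((T - 1 : ℕ) : ℝ) = T - 1 := by
            rw [Nat.cast_sub (by omega), Nat.cast_one]
          rw [← h1, ← Nat.cast_sum]
          exact_mod_cast this
        rw [← Finset.sum_mul, mul_div_assoc', div_le_div_iff₀ (by positivity) (by norm_num)]
        nlinarith

theorem IsRun.measure_not_delayGood_le (h : IsRun ch T δ μ ν P X ε τ) (hL : LipschitzWith 1 μ)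
    (hT : 2 ≤ T) (hδ : 0 < δ) {p : ℝ} {q : ℕ}
    (hq : ENNReal.ofReal p ≤ ν (Set.Iic (q : ℕ∞))) :
    P {ω | ¬ DelayGood (runAt ch T δ μ X ε τ ω) (fun s => τ s ω) T q p (logTerm T δ)} ≤
      ENNReal.ofReal (δ / 2) := by
  have hT0 : (0 : ℝ) < T := by exact_mod_cast (by omega : 0 < T)
  calc _ ≤ P (⋃ u ∈ Finset.range T, ⋃ s₀ ∈ Finset.range T, {ω | logTerm T δ ≤
          ∑ s ∈ Finset.range (u + 1), delayIncrement ch T δ μ X ε τ p q s₀ s ω}) := by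
        refine measure_mono fun ω hω => ?_
        obtain ⟨u, hu, s₀, hs₀, hdev⟩ := logTerm_le_of_not_delayGood hω
        exact Set.mem_iUnion₂.2 ⟨u, Finset.mem_range.2 hu,
          Set.mem_iUnion₂.2 ⟨s₀, Finset.mem_range.2 hs₀, hdev⟩⟩
    _ ≤ ∑ u ∈ Finset.range T, ∑ s₀ ∈ Finset.range T,
          ENNReal.ofReal (δ / (2 * (T : ℝ) ^ 2)) := by
        refine (measure_biUnion_finset_le _ _).trans (Finset.sum_le_sum fun u hu => ?_)
        refine (measure_biUnion_finset_le _ _).trans (Finset.sum_le_sum fun s₀ _ => ?_)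
        rw [← exp_neg_logTerm hT hδ]
        exact h.measure_delay_le hL hq (Finset.mem_range.1 hu) _
    _ = ENNReal.ofReal (δ / 2) := by
        rw [Finset.sum_const, Finset.sum_const, Finset.card_range, nsmul_eq_mul, nsmul_eq_mul,
          ← ENNReal.ofReal_natCast, ← ENNReal.ofReal_mul (by positivity),
          ← ENNReal.ofReal_mul (by positivity)]
        congr 1
        field_simp

/-- The regret bound for a fixed `p`. -/
theorem IsRun.regret_le [CompactSpace A] [Nonempty A] (h : IsRun ch T δ μ ν P X ε τ) {N : ℕ}
    (hN : IsDoubling A N) (hdiam : ∀ x y : A, dist x y ≤ 1) (hμ : ∀ x, μ x ∈ Set.Icc (0 : ℝ) 1)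
    (hL : LipschitzWith 1 μ) {c d : ℝ} (hz : HasZoomingBound μ c d) (hT : 2 ≤ T) (hδ : 0 < δ)
    (hδ1 : δ < 1) {p : ℝ} (hp : 0 < p) (hp1 : p ≤ 1) {q : ℕ}
    (hq : ENNReal.ofReal p ≤ ν (Set.Iic (q : ℕ∞))) :
    ENNReal.ofReal (1 - δ) ≤ P {ω | regret μ T X ω ≤ 1100 * N ^ 5 *
      (1 / p * (T : ℝ) ^ ((d + 1) / (d + 2)) * (c * Real.log (T / δ)) ^ (1 / (d + 2)) + q)} := by
  set good := {ω | regret μ T X ω ≤ 1100 * N ^ 5 *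
      (1 / p * (T : ℝ) ^ ((d + 1) / (d + 2)) * (c * Real.log (T / δ)) ^ (1 / (d + 2)) + q)}
  have hbad : P goodᶜ ≤ ENNReal.ofReal δ := by
    calc P goodᶜ ≤ P ({ω | ¬ NoiseGood (runAt ch T δ μ X ε τ ω) (fun s => ε s ω)
          (fun s => τ s ω) T δ} ∪ {ω | ¬ DelayGood (runAt ch T δ μ X ε τ ω) (fun s => τ s ω) T q p
            (logTerm T δ)}) := by
          refine measure_mono fun ω hω => ?_
          by_contra hnot
          rw [Set.mem_union, not_or] at hnot
          exact hω (sum_gap_le_of_good hN hdiam hμ hL hz hT hδ hδ1 (h.armsInBalls ω)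
            (not_not.1 hnot.1) hp hp1 (not_not.1 hnot.2))
      _ ≤ ENNReal.ofReal (δ / 2) + ENNReal.ofReal (δ / 2) :=
          (measure_union_le _ _).trans (add_le_add (h.measure_not_noiseGood_le hL hT hδ)
            (h.measure_not_delayGood_le hL hT hδ hq))
      _ = ENNReal.ofReal δ := by
          rw [← ENNReal.ofReal_add (by positivity) (by positivity), add_halves]
  have hone : 1 ≤ P good + ENNReal.ofReal δ := by
    calc (1 : ℝ≥0∞) = P (good ∪ goodᶜ) := by simp
      _ ≤ P good + P goodᶜ := measure_union_le _ _
      _ ≤ _ := by gcongr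
  rw [ENNReal.ofReal_sub _ hδ.le, ENNReal.ofReal_one]
  exact tsub_le_iff_right.2 hone

end GoodEvent

end DelayedLipschitz

/-! ### Choice of the quantile level -/

theorem theorem2 (N : ℕ) :
    ∃ C : ℝ, 0 < C ∧
      ∀ (A : Type*) [MetricSpace A] [CompactSpace A] [Nonempty A] [MeasurableSpace A]
        [BorelSpace A],
      IsDoubling A N → (∀ x y : A, dist x y ≤ 1) →
      ∀ μ : A → ℝ, (∀ x, μ x ∈ Set.Icc (0 : ℝ) 1) → LipschitzWith 1 μ →
      ∀ c d : ℝ, HasZoomingBound μ c d →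
      ∀ (T : ℕ) (δ : ℝ), 2 ≤ T → 0 < δ → δ < 1 →
      ∀ (ν : Measure ℕ∞) [IsProbabilityMeasure ν] (ch : Choices A)
        (Ω : Type*) [MeasurableSpace Ω] (P : Measure Ω) [IsProbabilityMeasure P]
        (X : ℕ → Ω → A) (ε : ℕ → Ω → ℝ) (τ : ℕ → Ω → ℕ∞),
      IsRun ch T δ μ ν P X ε τ →
      ENNReal.ofReal (1 - δ) ≤
        P {ω | ENNReal.ofReal (regret μ T X ω) ≤
          ENNReal.ofReal C * ⨅ p ∈ Set.Ioc (0 : ℝ) 1,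
            (ENNReal.ofReal (1 / p * (T : ℝ) ^ ((d + 1) / (d + 2)) *
                (c * Real.log (T / δ)) ^ (1 / (d + 2))) +
              ((quantile ν p : ℕ∞) : ℝ≥0∞))} := by
  refine ⟨2 * (1100 * N ^ 5) + 1, by positivity, ?_⟩
  intro A _ _ _ _ _ hN hdiam μ hμ hL c d hz T δ hT hδ hδ1 ν _ ch Ω _ P _ X ε τ h
  set b : ℝ := (T : ℝ) ^ ((d + 1) / (d + 2)) * (c * Real.log (T / δ)) ^ (1 / (d + 2)) with hb
  set V : ℝ → ℝ≥0∞ := fun p => ENNReal.ofReal (1 / p * (T : ℝ) ^ ((d + 1) / (d + 2)) *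
    (c * Real.log (T / δ)) ^ (1 / (d + 2))) + ((quantile ν p : ℕ∞) : ℝ≥0∞) with hV
  change _ ≤ P {ω | ENNReal.ofReal (regret μ T X ω) ≤
    ENNReal.ofReal (2 * (1100 * N ^ 5) + 1) * ⨅ p ∈ Set.Ioc (0 : ℝ) 1, V p}
  set I : ℝ≥0∞ := ⨅ p ∈ Set.Ioc (0 : ℝ) 1, V p with hI
  have hbpos : 0 < b := by
    have h1 := hz.1
    have h2 := one_le_logTerm hT hδ hδ1
    have h3 := logTerm_le hT hδ hδ1
    have h4 : 0 < Real.log (T / δ) := by linarith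
    have h5 : (0 : ℝ) < T := by exact_mod_cast (by omega : 0 < T)
    positivity
  have hI0 : I ≠ 0 := by
    refine (lt_of_lt_of_le (ENNReal.ofReal_pos.2 hbpos) (le_iInf₂ fun p hp => ?_)).ne'
    refine le_trans (ENNReal.ofReal_le_ofReal ?_) le_self_add
    rw [mul_assoc, ← hb]
    exact le_mul_of_one_le_left hbpos.le (one_le_one_div hp.1 hp.2)
  by_cases hItop : I = ⊤
  · have : ENNReal.ofReal (2 * (1100 * (N : ℝ) ^ 5) + 1) * I = ⊤ := by
      rw [hItop]
      exact ENNReal.mul_top (by rw [ne_eq, ENNReal.ofReal_eq_zero, not_le]; positivity)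
    simp [this, hδ.le]
  -- the infimum need not be attained, but some `p` comes within a factor two of it
  obtain ⟨p, hp, hpI⟩ : ∃ p ∈ Set.Ioc (0 : ℝ) 1, V p < 2 * I := by
    have : I < 2 * I := by
      rw [two_mul]
      exact ENNReal.lt_add_right hItop hI0
    simpa only [hI, iInf_lt_iff, exists_prop] using this
  have hqtop : quantile ν p < ⊤ := by
    rw [lt_top_iff_ne_top]
    intro htop
    have : V p = ⊤ := by simp [hV, htop]
    exact absurd (this ▸ hpI) not_top_lt
  obtain ⟨q, hqν, hqle⟩ : ∃ q : ℕ, ENNReal.ofReal p ≤ ν (Set.Iic (q : ℕ∞)) ∧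
      (q : ℕ∞) ≤ quantile ν p := by
    have h1 : quantile ν p < quantile ν p + 1 := (ENat.lt_add_one_iff hqtop.ne).2 le_rfl
    conv_lhs at h1 => rw [quantile]
    simp only [iInf_lt_iff] at h1
    obtain ⟨q, hq, h2⟩ := h1
    exact ⟨q, hq, (ENat.lt_add_one_iff hqtop.ne).1 h2⟩
  refine (h.regret_le hN hdiam hμ hL hz hT hδ hδ1 hp.1 hp.2 hqν).trans
    (measure_mono fun ω hω => ?_)
  have hpb : 0 ≤ 1 / p * (T : ℝ) ^ ((d + 1) / (d + 2)) *
      (c * Real.log (T / δ)) ^ (1 / (d + 2)) := by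
    rw [mul_assoc, ← hb]
    exact mul_nonneg (one_div_nonneg.2 hp.1.le) hbpos.le
  calc ENNReal.ofReal (regret μ T X ω)
      ≤ ENNReal.ofReal (1100 * N ^ 5 * (1 / p * (T : ℝ) ^ ((d + 1) / (d + 2)) *
          (c * Real.log (T / δ)) ^ (1 / (d + 2)) + q)) := ENNReal.ofReal_le_ofReal hω
    _ = ENNReal.ofReal (1100 * N ^ 5) * (ENNReal.ofReal (1 / p * (T : ℝ) ^ ((d + 1) / (d + 2)) *
          (c * Real.log (T / δ)) ^ (1 / (d + 2))) + (((q : ℕ) : ℕ∞) : ℝ≥0∞)) := by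
        rw [ENNReal.ofReal_mul (by positivity), ENNReal.ofReal_add hpb (Nat.cast_nonneg q),
          ENNReal.ofReal_natCast, ENat.toENNReal_coe]
    _ ≤ ENNReal.ofReal (1100 * N ^ 5) * V p := by
        gcongr
        exact add_le_add le_rfl (by exact_mod_cast hqle)
    _ ≤ ENNReal.ofReal (1100 * N ^ 5) * (2 * I) := by gcongr
    _ = ENNReal.ofReal (2 * (1100 * N ^ 5)) * I := by
        rw [ENNReal.ofReal_mul (by norm_num : (0 : ℝ) ≤ 2)]
        simp only [ENNReal.ofReal_ofNat]
        ring
    _ ≤ ENNReal.ofReal (2 * (1100 * N ^ 5) + 1) * I := by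
        gcongr
        linarith
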